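/- Let $n\in\mathbb N$ and let $\Gamma\subset E(n)=O(n)\ltimes\mathbb R^n$ be a Bieberbach group, i.e. a discrete, cocompact and torsion-free group of isometries of $\mathbb R^n$. Let $r(A,a)=A$ be its holonomy representation, and assume that $r$ takes values in $SO(n)$, i.e. that the flat manifold $\mathbb R^n/\Gamma$ is orientable; let $G=r(\Gamma)\subset SO(n)$ be the holonomy group. Let $C_n$ be the real Clifford algebra of $\mathbb R^n$, in which $v^2=-\|v\|^2$ for $v\in\mathbb R^n$, let $x\mapsto x'$ be its grading involution ($v'=-v$) and $x\mapsto\bar x$ the composition of $x\mapsto x'$ with the reversal of products. Let $Spin(n)$ be the group of all $x\in C_n$ with $x'=x$, $x\bar x=\bar x x=1$ and $x\,\mathbb R^n\,\bar x\subset\mathbb R^n$, with the topology induced from $C_n$, and let $\lambda_n\colon Spin(n)\to SO(n)$ be the homomorphism $\lambda_n(x)v=xv\bar x$. Let $Q$ be the principal $SO(n)$-bundle of oriented orthonormal frames of $X=\mathbb R^n/\Gamma$, for the metric and the orientation for which $\mathbb R^n\to X$ is an orientation preserving local isometry. A spin structure on $X$ is a pair $(P,\Lambda)$ of a principal $Spin(n)$-bundle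 $P\to X$ and a $2$-fold covering $\Lambda\colon P\to Q$ over $X$ such that $\Lambda(p\cdot g)=\Lambda(p)\cdot\lambda_n(g)$ for all $p\in P$, $g\in Spin(n)$. Two spin structures $(P_1,\Lambda_1)$ and $(P_2,\Lambda_2)$ are identified if there is a $Spin(n)$-equivariant homeomorphism $f\colon P_1\to P_2$ with $\Lambda_2\circ f=\Lambda_1$. Let $\varphi\colon G\to SO(n)$ be any representation that is equivalent over $\mathbb R$ to the inclusion $G\subset SO(n)$, i.e. there is $B\in GL(n,\mathbb R)$ with $\varphi(g)=BgB^{-1}$ for all $g\in G$. Then the set of spin structures on $\mathbb R^n/\Gamma$ is in bijection with the set of homomorphisms $\varepsilon\colon\Gamma\to Spin(n)$ such that $\lambda_n\circ\varepsilon=\varphi\circ r$. -/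

import Mathlib

open scoped Manifold ContDiff Topology

namespace FlatSpin

/-- Euclidean space `ℝⁿ`. -/
abbrev Euc (n : ℕ) : Type := EuclideanSpace ℝ (Fin n)

/-! ### Orthogonal, Clifford and spin groups -/

/-- The orthogonal group `O(n)`. -/
abbrev OrthGroup (n : ℕ) : Type := Euc n ≃ₗᵢ[ℝ] Euc n

/-- The special orthogonal group `SO(n)`. -/
def SO (n : ℕ) : Subgroup (OrthGroup n) where
  carrier := {A | LinearMap.det (A.toLinearEquiv : Euc n →ₗ[ℝ] Euc n) = 1}
  one_mem' := LinearMap.det_id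
  mul_mem' {A B} hA hB := by
    have h : ((A * B).toLinearEquiv : Euc n →ₗ[ℝ] Euc n)
        = (A.toLinearEquiv : Euc n →ₗ[ℝ] Euc n) ∘ₗ (B.toLinearEquiv : Euc n →ₗ[ℝ] Euc n) := rfl
    simp only [Set.mem_ofPred_eq] at hA hB ⊢
    rw [h, LinearMap.det_comp, hA, hB, mul_one]
  inv_mem' {A} hA := by
    have h : (A.toLinearEquiv : Euc n →ₗ[ℝ] Euc n)
        ∘ₗ ((A⁻¹).toLinearEquiv : Euc n →ₗ[ℝ] Euc n) = LinearMap.id := by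
      ext1 v
      exact A.apply_symm_apply v
    have h' := congrArg LinearMap.det h
    simp only [Set.mem_ofPred_eq] at hA ⊢
    rwa [LinearMap.det_comp, hA, one_mul, LinearMap.det_id] at h'

/-- The quadratic form `v ↦ -‖v‖²` on `ℝⁿ`. -/
noncomputable def negNormSq (n : ℕ) : QuadraticForm ℝ (Euc n) :=
  -LinearMap.BilinMap.toQuadraticMap (innerₗ (Euc n))

theorem negNormSq_apply {n : ℕ} (v : Euc n) : negNormSq n v = -‖v‖ ^ 2 := by
  simp [negNormSq]

/-- The Clifford algebra `C_n` with `e_i ^ 2 = -1` and `e_i e_j = - e_j e_i`. -/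
abbrev Cliff (n : ℕ) : Type := CliffordAlgebra (negNormSq n)

/-- The inclusion `ℝⁿ ⊂ C_n`. -/
noncomputable abbrev vec {n : ℕ} : Euc n →ₗ[ℝ] Cliff n := CliffordAlgebra.ι (negNormSq n)

theorem vec_sq {n : ℕ} (v : Euc n) :
    vec v * vec v = algebraMap ℝ (Cliff n) (-‖v‖ ^ 2) := by
  rw [CliffordAlgebra.ι_sq_scalar, negNormSq_apply]

theorem vec_injective {n : ℕ} : Function.Injective (vec (n := n)) := by
  rw [injective_iff_map_eq_zero]
  intro v hv
  have h := vec_sq v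
  rw [hv, mul_zero, eq_comm, map_eq_zero_iff _ (algebraMap ℝ (Cliff n)).injective] at h
  simpa using h

/-- The condition `x ℝⁿ x̄ ⊂ ℝⁿ`, where `x̄ = star x` is the composition of the grading involution
(`CliffordAlgebra.involute`) with the reversal (`CliffordAlgebra.reverse`). -/
def PreservesVectors {n : ℕ} (x : Cliff n) : Prop :=
  ∀ v : Euc n, ∃ w : Euc n, x * vec v * star x = vec w

theorem exists_conj {n : ℕ} {x : Cliff n} (hx : x ∈ unitary (Cliff n))
    (hv : PreservesVectors x) :
    ∃ A : OrthGroup n, ∀ v, x * vec v * star x = vec (A v) := by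
  choose f hf using hv
  have hadd : ∀ v w, f (v + w) = f v + f w := fun v w => vec_injective (by
    rw [← hf, map_add, map_add, ← hf, ← hf, mul_add, add_mul])
  have hsmul : ∀ (c : ℝ) v, f (c • v) = c • f v := fun c v => vec_injective (by
    rw [← hf, map_smul, map_smul, ← hf, mul_smul_comm, smul_mul_assoc])
  have hnorm : ∀ v, ‖f v‖ = ‖v‖ := fun v => by
    have h : vec (f v) * vec (f v) = vec v * vec v := by
      rw [← hf]
      calc x * vec v * star x * (x * vec v * star x)
          = x * vec v * (star x * x) * vec v * star x := by noncomm_ring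
        _ = x * (vec v * vec v) * star x := by
          rw [Unitary.star_mul_self_of_mem hx]; noncomm_ring
        _ = vec v * vec v := by
          rw [vec_sq, ← Algebra.commutes, mul_assoc, Unitary.mul_star_self_of_mem hx, mul_one]
    rw [vec_sq, vec_sq] at h
    have h2 := (algebraMap ℝ (Cliff n)).injective h
    have h3 : ‖f v‖ ^ 2 = ‖v‖ ^ 2 := by linarith
    exact (sq_eq_sq₀ (norm_nonneg _) (norm_nonneg _)).1 h3
  let F : Euc n →ₗᵢ[ℝ] Euc n := ⟨⟨⟨f, hadd⟩, hsmul⟩, hnorm⟩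
  exact ⟨F.toLinearIsometryEquiv rfl, hf⟩

/-- The group `Spin(n)`: all even `x ∈ C_n` with `x x̄ = 1 = x̄ x` and `x ℝⁿ x̄ ⊂ ℝⁿ`. For `n ≥ 1`
this is the group of products of an even number of unit vectors; for `n = 0` it is `{1, -1}`
(where Mathlib's `spinGroup`, being generated by vectors, would be trivial). -/
noncomputable def Spin (n : ℕ) : Subgroup (unitary (Cliff n)) where
  carrier := {x | CliffordAlgebra.involute (x : Cliff n) = x ∧ PreservesVectors (x : Cliff n)}
  one_mem' := ⟨by simp, fun v => ⟨v, by simp⟩⟩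
  mul_mem' {x y} hx hy := by
    refine ⟨?_, fun v => ?_⟩
    · rw [Submonoid.coe_mul, map_mul, hx.1, hy.1]
    · obtain ⟨w, hw⟩ := hy.2 v
      obtain ⟨u, hu⟩ := hx.2 w
      refine ⟨u, ?_⟩
      rw [← hu, ← hw, Submonoid.coe_mul, star_mul]
      noncomm_ring
  inv_mem' {x} hx := by
    have hinv : ((x⁻¹ : unitary (Cliff n)) : Cliff n) = star (x : Cliff n) := rfl
    refine ⟨?_, fun v => ?_⟩
    · rw [hinv, CliffordAlgebra.star_def, ← CliffordAlgebra.reverse_involute,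
        CliffordAlgebra.involute_involute, hx.1]
    · obtain ⟨A, hA⟩ := exists_conj x.2 hx.2
      refine ⟨A.symm v, ?_⟩
      have h := hA (A.symm v)
      rw [A.apply_symm_apply] at h
      rw [hinv, star_star, ← h]
      calc star (x : Cliff n) * (x * vec (A.symm v) * star (x : Cliff n)) * x
          = (star (x : Cliff n) * x) * vec (A.symm v) * (star (x : Cliff n) * x) := by noncomm_ring
        _ = vec (A.symm v) := by
          rw [Unitary.star_mul_self_of_mem x.2, one_mul, mul_one]

/-- `Spin(n)` has the subspace topology of the finite-dimensional real vector space `C_n`. -/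
noncomputable instance (n : ℕ) : TopologicalSpace (Spin n) :=
  TopologicalSpace.induced (fun x => ((x : unitary (Cliff n)) : Cliff n))
    (moduleTopology ℝ (Cliff n))

/-- Every orthogonal map is implemented, up to its determinant, by an invertible element of
`C_n` whose parity is given by the determinant. -/
theorem exists_implementer {n : ℕ} (A : OrthGroup n) :
    ∃ y : (Cliff n)ˣ, ∃ s : ℝ, s * s = 1 ∧
      LinearMap.det (A.toLinearEquiv : Euc n →ₗ[ℝ] Euc n) = s ∧
      CliffordAlgebra.involute (y : Cliff n) = s • (y : Cliff n) ∧
      ∀ w, (y : Cliff n) * vec w = s • (vec (A w) * y) := by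
  obtain ⟨l, -, rfl⟩ := A.reflections_generate_dim
  induction l with
  | nil =>
    exact ⟨1, 1, by norm_num, LinearMap.det_id, by simp, fun w => by simp⟩
  | cons v l ih =>
    obtain ⟨y, s, hs, hdet, hinv, hy⟩ := ih
    set B : OrthGroup n := (l.map fun v => (ℝ ∙ v)ᗮ.reflection).prod with hB
    rw [List.map_cons, List.prod_cons]
    by_cases hv : v = 0
    · have h1 : (ℝ ∙ v)ᗮ.reflection = (1 : OrthGroup n) := by
        subst hv
        ext1 w
        refine Submodule.reflection_mem_subspace_eq_self ?_
        rw [Submodule.span_zero_singleton, Submodule.bot_orthogonal_eq_top]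
        exact Submodule.mem_top
      rw [h1, one_mul]
      exact ⟨y, s, hs, hdet, hinv, hy⟩
    · have hunit : IsUnit (vec v) := CliffordAlgebra.isUnit_ι_of_isUnit (Q := negNormSq n) (by
        rw [negNormSq_apply, isUnit_iff_ne_zero]; simpa using hv)
      obtain ⟨u, hu⟩ := hunit
      refine ⟨u * y, -s, by simpa using hs, ?_, ?_, fun w => ?_⟩
      · have hc : (((ℝ ∙ v)ᗮ.reflection * B : OrthGroup n).toLinearEquiv : Euc n →ₗ[ℝ] Euc n)
          = ((ℝ ∙ v)ᗮ.reflection.toLinearEquiv : Euc n →ₗ[ℝ] Euc n)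
            ∘ₗ (B.toLinearEquiv : Euc n →ₗ[ℝ] Euc n) := rfl
        have hr := Submodule.det_reflection (𝕜 := ℝ) (ℝ ∙ v)ᗮ
        rw [Submodule.orthogonal_orthogonal, finrank_span_singleton hv, pow_one] at hr
        rw [hc, LinearMap.det_comp, hdet, hr]
        ring
      · rw [Units.val_mul, map_mul, hu, CliffordAlgebra.involute_ι, hinv]
        simp
      · have hkey : ∀ z : Euc n, vec v * vec z = -(vec ((ℝ ∙ v)ᗮ.reflection z) * vec v) := by
          intro z
          have hz : (ℝ ∙ v)ᗮ.reflection z = z - (2 * (inner ℝ v z / ‖v‖ ^ 2)) • v := by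
            rw [Submodule.reflection_orthogonal_apply, Submodule.reflection_singleton_apply]
            simp [mul_smul, two_smul]
            try abel
          have hsw := CliffordAlgebra.ι_mul_ι_add_swap (Q := negNormSq n) v z
          have hp : QuadraticMap.polar (negNormSq n) v z = -(2 * inner ℝ v z) := by
            simp only [QuadraticMap.polar, negNormSq_apply, norm_add_sq_real]
            ring
          have hv2 : ‖v‖ ^ 2 ≠ 0 := by simpa using hv
          rw [hz, map_sub, map_smul, sub_mul, smul_mul_assoc, vec_sq, neg_sub,
            Algebra.algebraMap_eq_smul_one, smul_smul, eq_sub_iff_add_eq, hsw, hp,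
            Algebra.algebraMap_eq_smul_one]
          congr 1
          field_simp
        rw [Units.val_mul, hu, mul_assoc, hy, mul_smul_comm, ← mul_assoc, hkey]
        rw [neg_mul, smul_neg, neg_smul, mul_assoc]
        rfl

theorem det_conj {n : ℕ} {x : Cliff n} (hx : x ∈ unitary (Cliff n))
    (he : CliffordAlgebra.involute x = x) {A : OrthGroup n}
    (hA : ∀ v, x * vec v * star x = vec (A v)) :
    LinearMap.det (A.toLinearEquiv : Euc n →ₗ[ℝ] Euc n) = 1 := by
  obtain ⟨y, s, hs, hdet, hinv, hy⟩ := exists_implementer A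
  rw [hdet]
  rcases mul_self_eq_one_iff.1 hs with h | h
  · exact h
  exfalso
  subst h
  have hxv : ∀ w, x * vec w = vec (A w) * x := fun w => by
    rw [← hA, mul_assoc, Unitary.star_mul_self_of_mem hx, mul_one]
  have hyi : CliffordAlgebra.involute (↑y⁻¹ : Cliff n) = -(↑y⁻¹ : Cliff n) := by
    have h : CliffordAlgebra.involute (y : Cliff n) * CliffordAlgebra.involute (↑y⁻¹ : Cliff n)
        = 1 := by
      rw [← map_mul, Units.mul_inv, map_one]
    rw [hinv] at h
    have h2 : (y : Cliff n) * (-CliffordAlgebra.involute (↑y⁻¹ : Cliff n)) = 1 := by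
      rw [← h]; simp
    have h3 := (Units.mul_eq_one_iff_inv_eq (u := y)).1 h2
    exact neg_eq_iff_eq_neg.1 h3.symm
  set z : Cliff n := (↑y⁻¹ : Cliff n) * x with hz
  have hzodd : CliffordAlgebra.involute z = -z := by
    rw [hz, map_mul, hyi, he, neg_mul]
  have hzv : ∀ w, z * vec w = -(vec w * z) := fun w => by
    have h := hy w
    have h2 : (y : Cliff n) * (vec w * z) = -((y : Cliff n) * (z * vec w)) := by
      rw [← mul_assoc, h, hz]
      simp only [← mul_assoc, Units.mul_inv, one_mul]
      rw [hxv, neg_smul, one_smul]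
      simp [mul_assoc]
    rw [← mul_neg] at h2
    have h3 := y.isUnit.mul_left_cancel h2
    rw [h3, neg_neg]
  have hcomm : ∀ u : Cliff n, z * u = CliffordAlgebra.involute u * z := by
    intro u
    induction u using CliffordAlgebra.induction with
    | algebraMap r => rw [AlgHom.commutes, Algebra.commutes]
    | ι w => rw [hzv, CliffordAlgebra.involute_ι, neg_mul]
    | mul a b ha hb => rw [← mul_assoc, ha, mul_assoc, hb, map_mul, mul_assoc]
    | add a b ha hb => rw [mul_add, ha, hb, map_add, add_mul]
  have hzz := hcomm z
  rw [hzodd, neg_mul] at hzz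
  have hzz0 : z * z = 0 := by
    have h2 : (2 : ℝ) • (z * z) = 0 := by
      rw [two_smul]
      exact eq_neg_iff_add_eq_zero.1 hzz
    exact (smul_eq_zero.1 h2).resolve_left two_ne_zero
  have hxu : IsUnit x := ⟨Unitary.toUnits ⟨x, hx⟩, rfl⟩
  have hzu : IsUnit z := (y⁻¹.isUnit).mul hxu
  exact (hzu.mul hzu).ne_zero hzz0

/-- The map `λ_n : Spin(n) → SO(n)`, `λ_n(x) v = x v x̄`, as a function; its defining property is
`spinCover_spec`. -/
noncomputable def spinCoverFun {n : ℕ} (x : Spin n) : SO n :=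
  ⟨(exists_conj x.1.2 x.2.2).choose,
    det_conj x.1.2 x.2.1 (exists_conj x.1.2 x.2.2).choose_spec⟩

theorem spinCoverFun_spec {n : ℕ} (x : Spin n) (v : Euc n) :
    (x : Cliff n) * vec v * star (x : Cliff n) = vec ((spinCoverFun x : OrthGroup n) v) :=
  (exists_conj x.1.2 x.2.2).choose_spec v

/-- The homomorphism `λ_n : Spin(n) → SO(n)`, `λ_n(x) v = x v x̄`. -/
noncomputable def spinCover (n : ℕ) : Spin n →* SO n where
  toFun := spinCoverFun
  map_one' := by
    ext1
    ext1 v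
    apply vec_injective
    rw [← spinCoverFun_spec]
    simp
  map_mul' x y := by
    ext1
    ext1 v
    apply vec_injective
    rw [← spinCoverFun_spec]
    change _ = vec ((spinCoverFun x : OrthGroup n) ((spinCoverFun y : OrthGroup n) v))
    rw [← spinCoverFun_spec, ← spinCoverFun_spec]
    simp only [Subgroup.coe_mul, Submonoid.coe_mul, star_mul]
    noncomm_ring

theorem spinCover_spec {n : ℕ} (x : Spin n) (v : Euc n) :
    (x : Cliff n) * vec v * star (x : Cliff n) = vec ((spinCover n x : OrthGroup n) v) :=
  spinCoverFun_spec x v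

/-! ### Euclidean motions and Bieberbach groups -/

/-- The group `E(n)` of isometries of `ℝⁿ`. -/
abbrev Motion (n : ℕ) : Type := Euc n ≃ᵃⁱ[ℝ] Euc n

/-- The rotational part `(A, a) ↦ A`, as a homomorphism `E(n) → O(n)`. -/
noncomputable def rot (n : ℕ) : Motion n →* OrthGroup n where
  toFun g := g.linearIsometryEquiv
  map_one' := rfl
  map_mul' _ _ := rfl

/-- The pair `(A, a)` with `g v = A v + a`, the matrix `A` being seen in `End(ℝⁿ)`. -/
noncomputable def motionPair {n : ℕ} (g : Motion n) : (Euc n →L[ℝ] Euc n) × Euc n :=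
  ((rot n g : Euc n →L[ℝ] Euc n), g 0)

/-- The standard topology of `E(n) = O(n) ⋉ ℝⁿ`. -/
noncomputable instance (n : ℕ) : TopologicalSpace (Motion n) :=
  TopologicalSpace.induced motionPair inferInstance

noncomputable instance (n : ℕ) : MulAction (Motion n) (Euc n) where
  smul g v := g v
  one_smul _ := rfl
  mul_smul _ _ _ := rfl

theorem motion_smul_def {n : ℕ} (g : Motion n) (v : Euc n) : g • v = g v := rfl

theorem motion_apply {n : ℕ} (g : Motion n) (v : Euc n) : g v = rot n g v + g 0 := by
  have h := g.map_vadd 0 v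
  rw [vadd_eq_add, vadd_eq_add, add_zero] at h
  exact h

theorem motionPair_injective {n : ℕ} : Function.Injective (motionPair (n := n)) := by
  intro g h hgh
  rw [motionPair, motionPair, Prod.mk.injEq] at hgh
  ext1 v
  rw [motion_apply g, motion_apply h, hgh.2]
  congr 1
  exact congrArg (fun T : Euc n →L[ℝ] Euc n => T v) hgh.1

instance (n : ℕ) : T2Space (Motion n) :=
  T2Space.of_injective_continuous motionPair_injective continuous_induced_dom

instance (n : ℕ) : IsTopologicalGroup (Motion n) where
  continuous_mul := by
    rw [continuous_induced_rng]
    have hc : Continuous (motionPair (n := n)) := continuous_induced_dom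
    have h1 := hc.comp (continuous_fst (X := Motion n) (Y := Motion n))
    have h2 := hc.comp (continuous_snd (X := Motion n) (Y := Motion n))
    have heq : (motionPair ∘ fun p : Motion n × Motion n => p.1 * p.2) = fun p =>
        ((motionPair p.1).1.comp (motionPair p.2).1,
          (motionPair p.1).1 (motionPair p.2).2 + (motionPair p.1).2) := by
      funext p
      refine Prod.ext rfl ?_
      exact motion_apply p.1 (p.2 0)
    rw [heq]
    exact ((h1.fst).clm_comp (h2.fst)).prodMk (((h1.fst).clm_apply h2.snd).add h1.snd)
  continuous_inv := by
    rw [continuous_induced_rng]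
    have hc : Continuous (motionPair (n := n)) := continuous_induced_dom
    have heq : (motionPair ∘ fun g : Motion n => g⁻¹) = fun g =>
        (ContinuousLinearMap.adjoint (motionPair g).1,
          -(ContinuousLinearMap.adjoint (motionPair g).1 (motionPair g).2)) := by
      funext g
      have hA : ((rot n g⁻¹ : OrthGroup n) : Euc n →L[ℝ] Euc n)
          = ContinuousLinearMap.adjoint ((rot n g : OrthGroup n) : Euc n →L[ℝ] Euc n) := by
        rw [LinearIsometryEquiv.adjoint_eq_symm, map_inv]
        rfl
      refine Prod.ext hA ?_
      have h := motion_apply g⁻¹ (g 0)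
      have h0 : g⁻¹ (g 0) = 0 := g.symm_apply_apply 0
      rw [h0] at h
      have h' : (g⁻¹ : Motion n) 0 = -((rot n g⁻¹ : OrthGroup n) (g 0)) :=
        (neg_eq_of_add_eq_zero_right h.symm).symm
      change (g⁻¹ : Motion n) 0 = -(ContinuousLinearMap.adjoint
        ((rot n g : OrthGroup n) : Euc n →L[ℝ] Euc n) (g 0))
      rw [h', ← hA]
      rfl
    rw [heq]
    have ha : Continuous fun g : Motion n => ContinuousLinearMap.adjoint (motionPair g).1 :=
      (LinearIsometryEquiv.continuous _).comp hc.fst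
    exact ha.prodMk (ha.clm_apply hc.snd).neg

theorem isClosedEmbedding_motionPair (n : ℕ) :
    Topology.IsClosedEmbedding (motionPair (n := n)) := by
  refine ⟨⟨⟨rfl⟩, motionPair_injective⟩, ?_⟩
  have hr : Set.range (motionPair (n := n))
      = ⋂ v : Euc n, {p : (Euc n →L[ℝ] Euc n) × Euc n | ‖p.1 v‖ = ‖v‖} := by
    ext p
    simp only [Set.mem_range, Set.mem_iInter, Set.mem_ofPred_eq]
    constructor
    · rintro ⟨g, rfl⟩ v
      exact (rot n g).norm_map v
    · intro h
      let F : Euc n →ₗᵢ[ℝ] Euc n := ⟨p.1, h⟩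
      let A : OrthGroup n := F.toLinearIsometryEquiv rfl
      have hA : ∀ v : Euc n, (fun v => A v + p.2) v
          = A (v -ᵥ (0 : Euc n)) +ᵥ (fun v => A v + p.2) 0 := fun v => by simp
      refine ⟨AffineIsometryEquiv.mk' (fun v => A v + p.2) A 0 hA, ?_⟩
      refine Prod.ext ?_ ?_
      · ext1 v
        exact congrArg (fun B : OrthGroup n => B v)
          (AffineIsometryEquiv.linearIsometryEquiv_mk' (fun v => A v + p.2) A 0 hA)
      · change A 0 + p.2 = p.2
        simp
  rw [hr]
  exact isClosed_iInter fun v =>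
    isClosed_eq ((continuous_fst.clm_apply continuous_const).norm) continuous_const

/-- `Γ ⊂ E(n)` is a Bieberbach group: discrete, cocompact and torsion-free. -/
class IsBieberbach {n : ℕ} (Γ : Subgroup (Motion n)) : Prop where
  discrete : DiscreteTopology Γ
  cocompact : CompactSpace (Motion n ⧸ Γ)
  torsionFree : ∀ γ ∈ Γ, IsOfFinOrder γ → γ = 1

instance {n : ℕ} (Γ : Subgroup (Motion n)) : ContinuousConstSMul Γ (Euc n) where
  continuous_const_smul γ := (γ : Motion n).continuous

instance {n : ℕ} (Γ : Subgroup (Motion n)) [h : IsBieberbach Γ] :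
    ProperlyDiscontinuousSMul Γ (Euc n) where
  finite_disjoint_inter_image := by
    intro K L hK hL
    have := h.discrete
    obtain ⟨R, hR⟩ := hK.isBounded.exists_norm_le
    obtain ⟨S, hS⟩ := hL.isBounded.exists_norm_le
    have hC : IsCompact (motionPair (n := n) ⁻¹' Metric.closedBall 0 (max 1 (S + R))) :=
      (isClosedEmbedding_motionPair n).isCompact_preimage (isCompact_closedBall _ _)
    have hfin := (Γ.tendsto_coe_cofinite_of_discrete ⟨h.discrete⟩) hC.compl_mem_cocompact
    rw [Filter.mem_map, Filter.mem_cofinite] at hfin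
    refine hfin.subset ?_
    rintro γ ⟨_, ⟨v, hv, rfl⟩, hw⟩
    simp only [Set.mem_compl_iff, Set.mem_preimage, not_not, mem_closedBall_zero_iff]
    refine max_le_max ?_ ?_
    · refine ContinuousLinearMap.opNorm_le_bound _ zero_le_one fun w => ?_
      rw [one_mul]
      exact ((rot n (γ : Motion n)).norm_map w).le
    · have h1 : (γ : Motion n) 0 = (γ : Motion n) v - rot n (γ : Motion n) v := by
        rw [motion_apply _ v]
        simp
      change ‖(γ : Motion n) 0‖ ≤ S + R
      rw [h1]
      refine (norm_sub_le _ _).trans (add_le_add (hS _ hw) ?_)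
      rw [LinearIsometryEquiv.norm_map]
      exact hR v hv

instance {n : ℕ} (Γ : Subgroup (Motion n)) [h : IsBieberbach Γ] : IsCancelSMul Γ (Euc n) := by
  rw [isCancelSMul_iff_eq_one_of_smul_eq]
  intro γ v hγ
  have hfin := ProperlyDiscontinuousSMul.finite_stabilizer (Γ := Γ) v
  have : Finite (MulAction.stabilizer Γ v) := hfin
  have hord : IsOfFinOrder (⟨γ, hγ⟩ : MulAction.stabilizer Γ v) := isOfFinOrder_of_finite _
  have h2 : IsOfFinOrder γ := (MulAction.stabilizer Γ v).subtype.isOfFinOrder hord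
  have h3 : IsOfFinOrder (γ : Motion n) := Γ.subtype.isOfFinOrder h2
  exact Subtype.ext (h.torsionFree _ γ.2 h3)

/-- The holonomy group `G = r(Γ)`. -/
noncomputable def holonomyGroup {n : ℕ} (Γ : Subgroup (Motion n)) : Subgroup (OrthGroup n) := Γ.map (rot n)

/-- The holonomy representation `r : Γ → G`, `r(A, a) = A`. -/
noncomputable def holonomyRep {n : ℕ} (Γ : Subgroup (Motion n)) : Γ →* holonomyGroup Γ := (rot n).subgroupMap Γ

/-! ### The flat manifold `ℝⁿ/Γ` -/

/-- The orbit space `X = ℝⁿ/Γ`, with the quotient topology. For a Bieberbach group it carries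
Mathlib's manifold charts given by the local sections of `ℝⁿ → ℝⁿ/Γ`. -/
abbrev FlatManifold {n : ℕ} (Γ : Subgroup (Motion n)) : Type :=
  MulAction.orbitRel.Quotient Γ (Euc n)

/-- The projection `π : ℝⁿ → ℝⁿ/Γ`. -/
noncomputable def orbitProj {n : ℕ} (Γ : Subgroup (Motion n)) : Euc n → FlatManifold Γ := Quotient.mk _

theorem isQuotientCoveringMap_orbitProj {n : ℕ} (Γ : Subgroup (Motion n)) [IsBieberbach Γ] :
    IsQuotientCoveringMap (orbitProj Γ) Γ :=
  isQuotientCoveringMap_quotientMk_of_properlyDiscontinuousSMul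

/-- A continuous self-map of `ℝⁿ` over `ℝⁿ/Γ` is locally given by an element of `Γ`. -/
theorem eventuallyEq_smul {n : ℕ} (Γ : Subgroup (Motion n)) [IsBieberbach Γ]
    {τ : Euc n → Euc n} {y : Euc n} (hτ : ContinuousAt τ y)
    (h : ∀ᶠ z in 𝓝 y, orbitProj Γ (τ z) = orbitProj Γ z) :
    ∃ γ : Γ, τ =ᶠ[𝓝 y] fun z => (γ : Motion n) z := by
  have hq := isQuotientCoveringMap_orbitProj Γ
  obtain ⟨γ, hγ⟩ := hq.apply_eq_iff_mem_orbit.1 h.self_of_nhds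
  obtain ⟨U, hU, hdis⟩ := hq.disjoint y
  have hγ' : γ⁻¹ • τ y = y := by
    rw [inv_smul_eq_iff]
    exact hγ.symm
  have hc : ContinuousAt (fun z => γ⁻¹ • τ z) y := (γ⁻¹ : Γ).1.continuous.continuousAt.comp hτ
  have hU' : ∀ᶠ z in 𝓝 y, γ⁻¹ • τ z ∈ U := hc (by rw [← hγ'] at hU; exact hU)
  refine ⟨γ, ?_⟩
  filter_upwards [h, hU, hU'] with z hz hzU hzU'
  obtain ⟨δ, hδ⟩ := hq.apply_eq_iff_mem_orbit.1 hz
  have hδ' : δ • z = τ z := hδ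
  have h1 : γ⁻¹ * δ = 1 := hdis _ ⟨γ⁻¹ • τ z, ⟨z, hzU, by rw [← hδ', ← mul_smul]⟩, hzU'⟩
  rw [inv_mul_eq_one] at h1
  rw [← hδ', ← h1]
  rfl

theorem coe_symm_of_mem_atlas {n : ℕ} {Γ : Subgroup (Motion n)} [IsBieberbach Γ]
    {e : OpenPartialHomeomorph (FlatManifold Γ) (Euc n)}
    (he : e ∈ atlas (Euc n) (FlatManifold Γ)) (y : Euc n) : e.symm y = orbitProj Γ y := by
  obtain ⟨q, rfl⟩ := he
  rw [OpenPartialHomeomorph.trans_symm_eq_symm_trans_symm, OpenPartialHomeomorph.coe_trans,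
    IsLocalHomeomorph.localInverseAt_symm]
  rfl

instance {n : ℕ} (Γ : Subgroup (Motion n)) [IsBieberbach Γ] (k : ℕ∞ω) :
    IsManifold 𝓘(ℝ, Euc n) k (FlatManifold Γ) := by
  refine isManifold_of_contDiffOn _ _ _ fun e e' he he' => ?_
  have key : ContDiffOn ℝ k (e.symm ≫ₕ e') (e.symm ≫ₕ e').source := by
    intro y hy
    have hopen := (e.symm ≫ₕ e').open_source.mem_nhds hy
    obtain ⟨γ, hγ⟩ := eventuallyEq_smul Γ (τ := e.symm ≫ₕ e') (y := y)
      ((e.symm ≫ₕ e').continuousAt hy) (by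
        filter_upwards [hopen] with z hz
        rw [OpenPartialHomeomorph.coe_trans, Function.comp_apply, ← coe_symm_of_mem_atlas he',
          e'.left_inv (show e.symm z ∈ e'.source from hz.2), coe_symm_of_mem_atlas he])
    have hsm : ContDiffAt ℝ k (fun z => (γ : Motion n) z) y :=
      (γ : Motion n).toContinuousAffineEquiv.toContinuousAffineMap.contDiff.contDiffAt
    exact (hsm.congr_of_eventuallyEq hγ).contDiffWithinAt
  simpa using key

/-- The projection `π` is smooth, so that its derivatives `dπ_e` are genuine. -/
theorem contMDiff_orbitProj {n : ℕ} (Γ : Subgroup (Motion n)) [IsBieberbach Γ] (k : ℕ∞ω) :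
    ContMDiff 𝓘(ℝ, Euc n) 𝓘(ℝ, Euc n) k (orbitProj Γ) := by
  intro y
  have hq := isQuotientCoveringMap_orbitProj Γ
  have hc : Continuous (orbitProj Γ) := hq.isCoveringMap.continuous
  rw [contMDiffAt_iff]
  refine ⟨hc.continuousAt, ?_⟩
  set e := chartAt (Euc n) (orbitProj Γ y) with he
  have hes : e.source ∈ 𝓝 (orbitProj Γ y) := e.open_source.mem_nhds (mem_chart_source _ _)
  obtain ⟨γ, hγ⟩ := eventuallyEq_smul Γ (τ := e ∘ orbitProj Γ) (y := y)
    ((e.continuousAt (mem_chart_source _ _)).comp hc.continuousAt) (by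
      filter_upwards [hc.continuousAt hes] with z hz
      rw [Function.comp_apply, ← coe_symm_of_mem_atlas (chart_mem_atlas _ (orbitProj Γ y)),
        ← he, e.left_inv hz])
  have hsm : ContDiffAt ℝ k (fun z => (γ : Motion n) z) y :=
    (γ : Motion n).toContinuousAffineEquiv.toContinuousAffineMap.contDiff.contDiffAt
  have h2 := (hsm.congr_of_eventuallyEq hγ)
  simp only [mfld_simps]
  exact h2.contDiffWithinAt

/-! ### The oriented orthonormal frame bundle -/

/-- The oriented orthonormal frames of `X = ℝⁿ/Γ`: pairs of a point `x : X` and a linear map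
`f : ℝⁿ → T_x X` of the form `dπ_e ∘ A` with `π(e) = x` and `A ∈ SO(n)`. These are the oriented
orthonormal frames for the metric and the orientation of `X` that make `π` an orientation
preserving local isometry. -/
def FrameBundle {n : ℕ} (Γ : Subgroup (Motion n)) [IsBieberbach Γ] : Type :=
  {F : Σ x : FlatManifold Γ, Euc n →L[ℝ] TangentSpace 𝓘(ℝ, Euc n) x //
    ∃ (e : Euc n) (A : SO n), F = ⟨orbitProj Γ e,
      (mfderiv 𝓘(ℝ, Euc n) 𝓘(ℝ, Euc n) (orbitProj Γ) e).comp
        ((A : OrthGroup n) : Euc n →L[ℝ] Euc n)⟩}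

namespace FrameBundle

variable {n : ℕ} {Γ : Subgroup (Motion n)} [IsBieberbach Γ]

/-- The projection `Q → X`. -/
def proj (F : FrameBundle Γ) : FlatManifold Γ := F.1.1

/-- The `i`-th vector of a frame, as a point of the tangent bundle of `X`. -/
noncomputable def vector (F : FrameBundle Γ) (i : Fin n) :
    TangentBundle 𝓘(ℝ, Euc n) (FlatManifold Γ) :=
  ⟨F.1.1, F.1.2 (EuclideanSpace.single i 1)⟩

/-- The topology of the frame bundle as a subspace of `X × (TX)ⁿ`. -/
noncomputable instance : TopologicalSpace (FrameBundle Γ) :=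
  TopologicalSpace.induced (fun F => (F.proj, fun i => F.vector i)) inferInstance

/-- The right action of `SO(n)` on frames, `f · A = f ∘ A`. -/
noncomputable def act (F : FrameBundle Γ) (A : SO n) : FrameBundle Γ :=
  ⟨⟨F.1.1, F.1.2.comp ((A : OrthGroup n) : Euc n →L[ℝ] Euc n)⟩, by
    obtain ⟨⟨x, f⟩, e, B, hF⟩ := F
    refine ⟨e, B * A, ?_⟩
    cases hF
    rfl⟩

end FrameBundle

/-! ### Spin structures -/

/-- A spin structure `(P, Λ)` on the flat manifold `X = ℝⁿ/Γ`, where `Q → X` is its bundle of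
oriented orthonormal frames: a principal `Spin(n)`-bundle `P → X` with a 2-fold covering
`Λ : P → Q` over `X` that satisfies `Λ(p · g) = Λ(p) · λ_n(g)`. -/
structure SpinStructure {n : ℕ} (Γ : Subgroup (Motion n)) [IsBieberbach Γ] where
  /-- the total space -/
  P : Type
  [top : TopologicalSpace P]
  /-- the bundle projection -/
  proj : P → FlatManifold Γ
  /-- the right action of `Spin(n)` -/
  act : P → Spin n → P
  act_one : ∀ p, act p 1 = p
  act_mul : ∀ p g h, act p (g * h) = act (act p g) h
  continuous_act : Continuous fun p : P × Spin n => act p.1 p.2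
  proj_act : ∀ p g, proj (act p g) = proj p
  locally_trivial : ∀ x, ∃ t : Bundle.Trivialization (Spin n) proj, x ∈ t.baseSet ∧
    ∀ p g, proj p ∈ t.baseSet → (t (act p g)).2 = (t p).2 * g
  /-- the map to the frame bundle -/
  lam : P → FrameBundle Γ
  isCoveringMap_lam : IsCoveringMap lam
  two_fold : ∀ q, (lam ⁻¹' {q}).ncard = 2
  proj_lam : ∀ p, (lam p).proj = proj p
  lam_act : ∀ p g, lam (act p g) = (lam p).act (spinCover n g)

attribute [instance] SpinStructure.top

/-- Two spin structures are equivalent if there is a `Spin(n)`-equivariant homeomorphism between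
their total spaces that commutes with the maps to the frame bundle. -/
def SpinStructure.Equivalent {n : ℕ} {Γ : Subgroup (Motion n)} [IsBieberbach Γ]
    (σ τ : SpinStructure Γ) : Prop :=
  ∃ f : σ.P ≃ₜ τ.P, (∀ p g, f (σ.act p g) = τ.act (f p) g) ∧ ∀ p, τ.lam (f p) = σ.lam p

instance SpinStructure.setoid {n : ℕ} (Γ : Subgroup (Motion n)) [IsBieberbach Γ] :
    Setoid (SpinStructure Γ) where
  r := SpinStructure.Equivalent
  iseqv :=
    { refl := fun σ => ⟨Homeomorph.refl _, fun _ _ => rfl, fun _ => rfl⟩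
      symm := fun {σ τ} ⟨f, hf, hl⟩ => ⟨f.symm, fun p g => f.injective (by simp [hf]),
        fun p => by rw [← hl, f.apply_symm_apply]⟩
      trans := fun {σ τ ρ} ⟨f, hf, hl⟩ ⟨f', hf', hl'⟩ => ⟨f.trans f',
        fun p g => by simp [hf, hf'], fun p => by simp [hl, hl']⟩ }

/-- The set of spin structures on `ℝⁿ/Γ` (up to equivalence). -/
abbrev SpinStructures {n : ℕ} (Γ : Subgroup (Motion n)) [IsBieberbach Γ] : Type 1 :=
  Quotient (SpinStructure.setoid Γ)

/-- `φ : G → SO(n)` is equivalent, as a real representation, to the inclusion of `G` in the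
orthogonal group. -/
def EquivalentToInclusion {n : ℕ} {G : Subgroup (OrthGroup n)} (φ : G →* SO n) : Prop :=
  ∃ B : Euc n ≃ₗ[ℝ] Euc n, ∀ (g : G) (v : Euc n),
    (φ g : OrthGroup n) (B v) = B ((g : OrthGroup n) v)

end FlatSpin

open FlatSpin

/-! The tautological frame `e ↦ dπ_e` along `π : ℝⁿ → X = ℝⁿ/Γ` satisfies `dπ_{γe} ∘ r(γ) = dπ_e`,
because `π ∘ γ = π`. Thus `Q` is `(ℝⁿ × SO(n))/Γ` with `Γ` acting on `SO(n)` through `r`, and a spin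
structure amounts to a lift of `r` to `Spin(n)`.

A lift `ε` gives `P = (ℝⁿ × Spin(n))/Γ` with `Λ[e, g] = dπ_e ∘ λ_n(g)` (`spinStructureOfHom`).
Conversely, for a spin structure `(P, Λ)` the tautological frame lifts through `Λ` to a map `s : ℝⁿ
→ P` (`SpinStructure.exists_isFrameLift`). Uniqueness of lifts gives `s(γe) = s(e) ε(γ)⁻¹` with one
`ε(γ)` for all `e`; freeness of the action makes `ε` a homomorphism (`IsFrameLift.exists_hom`), and
`[e, g] ↦ s(e) g` identifies the model with `P` (`IsFrameLift.equivalent`). Another choice of `s`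
differs by an element of the central subgroup `ker λ_n`, so `ε` does not change
(`IsFrameLift.hom_unique`). Together these give `nonempty_equiv_lifts`.

Three facts on `Spin(n)` are needed: `ker λ_n = {1, -1}`, `λ_n` is onto, and `Spin(n)` is compact.
Compactness of the model, which also uses that `Γ` is cocompact, shows that `Λ` is a quotient map
and that the comparison with `P` is a homeomorphism.

To pass from `r` to `φ ∘ r`, the equivalence `B` is replaced by the orthogonal factor `C` of its
polar decomposition (`exists_orthogonal_intertwiner`). Conjugation by `C` lifts to `Spin(n)` through
the automorphism of `C_n` that `C` induces (`spinCover_spinMap`), and composition with this lift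
matches the two sets of homomorphisms. -/

namespace FlatSpin

/-! ### Structure of the Clifford algebra -/

section Clifford

variable {n : ℕ}

/-- The generator `e_i` of `C_n`. -/
noncomputable def gen (i : Fin n) : Cliff n := vec (EuclideanSpace.single i (1 : ℝ))

theorem gen_mul_self (i : Fin n) : gen i * gen i = -1 := by
  rw [gen, vec_sq]
  simp

theorem gen_mul_gen_of_ne {i j : Fin n} (h : i ≠ j) : gen i * gen j = -(gen j * gen i) := by
  have hp : QuadraticMap.polar (negNormSq n) (EuclideanSpace.single i (1 : ℝ))
      (EuclideanSpace.single j (1 : ℝ)) = 0 := by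
    simp only [QuadraticMap.polar, negNormSq_apply, norm_add_sq_real]
    simp [EuclideanSpace.inner_single_left, h]
  have := CliffordAlgebra.ι_mul_ι_add_swap (Q := negNormSq n)
    (EuclideanSpace.single i (1 : ℝ)) (EuclideanSpace.single j (1 : ℝ))
  rw [hp, map_zero] at this
  exact eq_neg_of_add_eq_zero_left this

theorem vec_eq_sum_gen (v : Euc n) : vec v = ∑ i, v i • gen i := by
  have h : v = ∑ i, v i • EuclideanSpace.single i (1 : ℝ) := by
    ext j
    simp [Finset.sum_apply, Pi.single_apply]
  conv_lhs => rw [h]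
  simp [gen]

/-- The subalgebra generated by the `e_i` with `i ∈ s`. -/
noncomputable def genAlgebra (s : Set (Fin n)) : Subalgebra ℝ (Cliff n) :=
  Algebra.adjoin ℝ (gen '' s)

theorem gen_mem_genAlgebra {s : Set (Fin n)} {i : Fin n} (h : i ∈ s) : gen i ∈ genAlgebra s :=
  Algebra.subset_adjoin ⟨i, h, rfl⟩

theorem genAlgebra_univ : genAlgebra (Set.univ : Set (Fin n)) = ⊤ := by
  rw [eq_top_iff, ← CliffordAlgebra.adjoin_range_ι, Algebra.adjoin_le_iff]
  rintro _ ⟨v, rfl⟩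
  rw [vec_eq_sum_gen]
  exact sum_mem fun i _ => Subalgebra.smul_mem _ (gen_mem_genAlgebra (Set.mem_univ i)) _

/-- Moving `e_i` across a product of other generators costs one sign per factor, which is what the
grading involution records. -/
theorem genAlgebra_mul_gen {s : Set (Fin n)} {i : Fin n} (hi : i ∉ s) {a : Cliff n}
    (ha : a ∈ genAlgebra s) :
    CliffordAlgebra.involute a ∈ genAlgebra s ∧
      a * gen i = gen i * CliffordAlgebra.involute a := by
  induction ha using Algebra.adjoin_induction with
  | mem x hx =>
    obtain ⟨j, hj, rfl⟩ := hx
    have hne : j ≠ i := fun h => hi (h ▸ hj)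
    have hinv : CliffordAlgebra.involute (gen j) = -gen j := CliffordAlgebra.involute_ι _
    rw [hinv, gen_mul_gen_of_ne hne, mul_neg]
    exact ⟨neg_mem (gen_mem_genAlgebra hj), rfl⟩
  | algebraMap r =>
    rw [AlgHom.commutes]
    exact ⟨Subalgebra.algebraMap_mem _ r, Algebra.commutes _ _⟩
  | add x y _ _ hx hy =>
    rw [map_add]
    exact ⟨add_mem hx.1 hy.1, by rw [add_mul, hx.2, hy.2, mul_add]⟩
  | mul x y _ _ hx hy =>
    rw [map_mul]
    exact ⟨mul_mem hx.1 hy.1, by rw [mul_assoc, hy.2, ← mul_assoc, hx.2, mul_assoc]⟩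

/-- With `A` the algebra on `s`, the space `A + e_i A` is closed under products, since `e_i`
commutes with `A` up to the involution and `e_i² = -1`. This serves both to find the even center and
to bound the dimension. -/
theorem exists_eq_add_gen_mul {s : Set (Fin n)} {i : Fin n} (hi : i ∉ s) {x : Cliff n}
    (hx : x ∈ genAlgebra (insert i s)) :
    ∃ a ∈ genAlgebra s, ∃ b ∈ genAlgebra s, x = a + gen i * b := by
  induction hx using Algebra.adjoin_induction with
  | mem x hx =>
    obtain ⟨j, hj, rfl⟩ := hx
    rcases hj with rfl | hj
    · exact ⟨0, zero_mem _, 1, one_mem _, by simp⟩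
    · exact ⟨gen j, gen_mem_genAlgebra hj, 0, zero_mem _, by simp⟩
  | algebraMap r => exact ⟨_, Subalgebra.algebraMap_mem _ r, 0, zero_mem _, by simp⟩
  | add x y _ _ hx hy =>
    obtain ⟨a, ha, b, hb, rfl⟩ := hx
    obtain ⟨c, hc, d, hd, rfl⟩ := hy
    exact ⟨a + c, add_mem ha hc, b + d, add_mem hb hd, by noncomm_ring⟩
  | mul x y _ _ hx hy =>
    obtain ⟨a, ha, b, hb, rfl⟩ := hx
    obtain ⟨c, hc, d, hd, rfl⟩ := hy
    obtain ⟨ha', hag⟩ := genAlgebra_mul_gen hi ha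
    obtain ⟨hb', hbg⟩ := genAlgebra_mul_gen hi hb
    refine ⟨a * c - CliffordAlgebra.involute b * d,
      sub_mem (mul_mem ha hc) (mul_mem hb' hd), CliffordAlgebra.involute a * d + b * c,
      add_mem (mul_mem ha' hd) (mul_mem hb hc), ?_⟩
    have h1 : a * (gen i * d) = gen i * (CliffordAlgebra.involute a * d) := by
      rw [← mul_assoc, hag, mul_assoc]
    have h2 : gen i * b * (gen i * d) = -(CliffordAlgebra.involute b * d) := by
      calc gen i * b * (gen i * d) = gen i * (b * gen i) * d := by noncomm_ring
        _ = (gen i * gen i) * (CliffordAlgebra.involute b * d) := by rw [hbg]; noncomm_ring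
        _ = _ := by rw [gen_mul_self, neg_one_mul]
    rw [add_mul, mul_add, mul_add, h1, h2, mul_add, mul_assoc]
    abel

theorem mem_genAlgebra_of_commute {s : Set (Fin n)} {i : Fin n} (hi : i ∉ s) {x : Cliff n}
    (hx : x ∈ genAlgebra (insert i s)) (he : CliffordAlgebra.involute x = x)
    (hc : gen i * x = x * gen i) : x ∈ genAlgebra s := by
  obtain ⟨a, ha, b, hb, rfl⟩ := exists_eq_add_gen_mul hi hx
  obtain ⟨hb', -⟩ := genAlgebra_mul_gen hi hb
  obtain ⟨ha', -⟩ := genAlgebra_mul_gen hi ha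
  have hbg := (genAlgebra_mul_gen hi hb').2
  have hag := (genAlgebra_mul_gen hi ha').2
  rw [CliffordAlgebra.involute_involute] at hbg hag
  have hinv : CliffordAlgebra.involute (gen i) = -gen i := CliffordAlgebra.involute_ι _
  -- As `x = x'`, the relation may be written `e_i x = x' e_i`. Moving `e_i` to the left past `a'`
  -- and `b'` removes the involutions and leaves `-b = b`.
  rw [← he] at hc
  nth_rewrite 1 [he] at hc
  rw [map_add, map_mul, hinv, mul_add, add_mul, hag, ← mul_assoc, gen_mul_self, mul_assoc, hbg,
    neg_mul, neg_mul, ← mul_assoc, gen_mul_self, neg_mul, neg_neg, one_mul,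
    add_right_inj] at hc
  have hb0 : b = 0 := by
    have h2 : (2 : ℝ) • b = 0 := by
      rw [two_smul]
      exact neg_eq_iff_add_eq_zero.1 hc
    exact (smul_eq_zero.1 h2).resolve_left two_ne_zero
  rw [hb0, mul_zero, add_zero]
  exact ha

/-- The even elements of the center of `C_n` are the scalars. -/
theorem exists_algebraMap_eq_of_commute {x : Cliff n} (he : CliffordAlgebra.involute x = x)
    (hc : ∀ v, vec v * x = x * vec v) : ∃ r : ℝ, algebraMap ℝ (Cliff n) r = x := by
  -- The generators are eliminated one at a time; when none is left, only scalars remain.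
  have h : ∀ s : Finset (Fin n), x ∈ genAlgebra {j | j ∉ s} := by
    intro s
    induction s using Finset.induction_on with
    | empty =>
      have : {j : Fin n | j ∉ (∅ : Finset (Fin n))} = Set.univ := by ext; simp
      rw [this, genAlgebra_univ]
      exact Algebra.mem_top
    | insert i s hi ih =>
      refine mem_genAlgebra_of_commute (i := i) (by simp) ?_ he (hc _)
      have : insert i {j | j ∉ insert i s} = {j | j ∉ s} := by
        ext j
        by_cases hj : j = i
        · simp [hj, hi]
        · simp [hj]
      rwa [this]
  have h1 := h Finset.univ
  simp only [Finset.mem_univ, not_true_eq_false, genAlgebra, Set.ofPred_false, Set.image_empty,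
    Algebra.adjoin_empty] at h1
  exact Algebra.mem_bot.1 h1

/-- Each further generator at most doubles the dimension, because `A` grows to `A + e_i A`. -/
instance finiteDimensional_cliff : FiniteDimensional ℝ (Cliff n) := by
  have h : ∀ s : Finset (Fin n),
      FiniteDimensional ℝ (Subalgebra.toSubmodule (genAlgebra (s : Set (Fin n)))) := by
    intro s
    induction s using Finset.induction_on with
    | empty =>
      have h0 : genAlgebra ((∅ : Finset (Fin n)) : Set (Fin n)) = ⊥ := by simp [genAlgebra]
      rw [h0, Algebra.toSubmodule_bot, Submodule.one_eq_span]
      infer_instance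
    | insert i s hi ih =>
      set S := Subalgebra.toSubmodule (genAlgebra (s : Set (Fin n)))
      have hle : Subalgebra.toSubmodule (genAlgebra ((insert i s : Finset (Fin n)) : Set (Fin n)))
          ≤ S ⊔ S.map (LinearMap.mulLeft ℝ (gen i)) := by
        intro x hx
        rw [Finset.coe_insert] at hx
        obtain ⟨a, ha, b, hb, rfl⟩ := exists_eq_add_gen_mul (by simpa using hi) hx
        exact Submodule.add_mem_sup ha ⟨b, hb, rfl⟩
      exact Submodule.finiteDimensional_of_le hle
  have h1 := h Finset.univ
  rw [Finset.coe_univ, genAlgebra_univ, Algebra.top_toSubmodule] at h1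
  exact LinearEquiv.finiteDimensional (Submodule.topEquiv : _ ≃ₗ[ℝ] Cliff n)

end Clifford

/-! ### The spin covering as a group homomorphism -/

section SpinCover

variable {n : ℕ}

theorem spin_coe_injective :
    Function.Injective (fun x : Spin n => ((x : unitary (Cliff n)) : Cliff n)) :=
  Subtype.coe_injective.comp Subtype.coe_injective

theorem spin_mul_vec (x : Spin n) (v : Euc n) :
    (x : Cliff n) * vec v = vec ((spinCover n x : OrthGroup n) v) * x := by
  rw [← spinCover_spec, mul_assoc _ (star _), Unitary.star_mul_self_of_mem x.1.2, mul_one]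

theorem spinCover_eq_iff (x : Spin n) (A : SO n) :
    spinCover n x = A ↔ ∀ v, (x : Cliff n) * vec v = vec ((A : OrthGroup n) v) * x := by
  refine ⟨fun h v => h ▸ spin_mul_vec x v, fun h => ?_⟩
  ext1
  ext1 v
  apply vec_injective
  rw [← spinCover_spec, h, mul_assoc, Unitary.mul_star_self_of_mem x.1.2, mul_one]

/-- The element `-1` of `Spin(n)`. -/
noncomputable def spinNegOne (n : ℕ) : Spin n :=
  ⟨⟨-1, by rw [Unitary.mem_iff]; simp⟩, by simp, fun v => ⟨v, by simp⟩⟩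

/-- An element of the kernel is even and commutes with all vectors, hence is a scalar `r`; then `x
x̄ = 1` reads `r² = 1`. -/
theorem spinCover_eq_one_iff {x : Spin n} : spinCover n x = 1 ↔ x = 1 ∨ x = spinNegOne n := by
  rw [spinCover_eq_iff]
  constructor
  · intro h
    obtain ⟨r, hr⟩ := exists_algebraMap_eq_of_commute x.2.1 fun v => (h v).symm
    have h1 := Unitary.mul_star_self_of_mem x.1.2
    rw [← hr, CliffordAlgebra.star_algebraMap, ← map_mul,
      ← map_one (algebraMap ℝ (Cliff n))] at h1
    rcases mul_self_eq_one_iff.1 ((algebraMap ℝ (Cliff n)).injective h1) with h2 | h2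
    · left
      apply spin_coe_injective
      simp [← hr, h2]
    · right
      apply spin_coe_injective
      simp [← hr, h2, spinNegOne]
  · rintro (rfl | rfl) v
    · simp
    · simp [spinNegOne]

theorem one_ne_spinNegOne : (1 : Spin n) ≠ spinNegOne n := by
  intro h
  have h1 : (1 : Cliff n) = -1 := congrArg (fun x : Spin n => (x : Cliff n)) h
  rw [← map_one (algebraMap ℝ (Cliff n)), ← map_neg] at h1
  have := (algebraMap ℝ (Cliff n)).injective h1
  norm_num at this

theorem card_ker_spinCover : Nat.card (spinCover n).ker = 2 := by
  have h : ((spinCover n).ker : Set (Spin n)) = {1, spinNegOne n} := by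
    ext x
    exact spinCover_eq_one_iff
  change Nat.card ((spinCover n).ker : Set (Spin n)) = 2
  rw [h, Nat.card_coe_set_eq, Set.ncard_pair one_ne_spinNegOne]

instance : Finite (spinCover n).ker :=
  Nat.finite_of_card_ne_zero (by rw [card_ker_spinCover]; norm_num)

theorem mul_comm_of_spinCover_eq_one {c : Spin n} (hc : spinCover n c = 1) (x : Spin n) :
    c * x = x * c := by
  rcases spinCover_eq_one_iff.1 hc with rfl | rfl
  · simp
  · apply spin_coe_injective
    simp [spinNegOne]

/-- The elements `1`, `-1` and the unit vectors of `C_n`. -/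
def unitVectors (n : ℕ) : Set (Cliff n) := {1, -1} ∪ vec '' Metric.sphere 0 1

/-- The relation `v z + z v = -2⟨v, z⟩` is the reflection formula in disguise. The minus sign
accounts for the determinant `-1` of a reflection. -/
theorem vec_mul_vec_eq_neg_reflection {v : Euc n} (hv : ‖v‖ = 1) (z : Euc n) :
    vec v * vec z = -(vec ((ℝ ∙ v)ᗮ.reflection z) * vec v) := by
  have hz : (ℝ ∙ v)ᗮ.reflection z = z - (2 * inner ℝ v z) • v := by
    rw [Submodule.reflection_orthogonal_apply, Submodule.reflection_singleton_apply]
    simp [hv, mul_smul, two_smul]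
  have hsw := CliffordAlgebra.ι_mul_ι_add_swap (Q := negNormSq n) v z
  have hp : QuadraticMap.polar (negNormSq n) v z = -(2 * inner ℝ v z) := by
    simp only [QuadraticMap.polar, negNormSq_apply, norm_add_sq_real]
    ring
  rw [hz, map_sub, map_smul, sub_mul, smul_mul_assoc, vec_sq, neg_sub,
    Algebra.algebraMap_eq_smul_one, smul_smul, eq_sub_iff_add_eq, hsw, hp,
    Algebra.algebraMap_eq_smul_one]
  simp [hv]

-- A product of reflections is implemented by the product of the normalised vectors. Compared with
-- `exists_implementer`, the element is unitary and a word of controlled length in a compact set, as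
-- compactness of `Spin(n)` requires. A zero vector in the list gives the identity and contributes
-- the letter `1`.
open Pointwise in
theorem exists_unitary_implementer (l : List (Euc n)) :
    ∃ y ∈ unitary (Cliff n), ∃ s : ℝ, s * s = 1 ∧ y ∈ unitVectors n ^ l.length ∧
      LinearMap.det (((l.map fun v => (ℝ ∙ v)ᗮ.reflection).prod : OrthGroup n).toLinearEquiv :
        Euc n →ₗ[ℝ] Euc n) = s ∧
      CliffordAlgebra.involute y = s • y ∧
      ∀ w, y * vec w = s • (vec (((l.map fun v => (ℝ ∙ v)ᗮ.reflection).prod : OrthGroup n) w)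
        * y) := by
  induction l with
  | nil =>
    exact ⟨1, one_mem _, 1, by norm_num, by simp, LinearMap.det_id, by simp, fun w => by simp⟩
  | cons v l ih =>
    obtain ⟨y, hyu, s, hs, hyl, hdet, hinv, hy⟩ := ih
    set B : OrthGroup n := (l.map fun v => (ℝ ∙ v)ᗮ.reflection).prod with hB
    rw [List.map_cons, List.prod_cons, List.length_cons, pow_succ']
    by_cases hv : v = 0
    · have h1 : (ℝ ∙ v)ᗮ.reflection = (1 : OrthGroup n) := by
        subst hv
        ext1 w
        refine Submodule.reflection_mem_subspace_eq_self ?_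
        rw [Submodule.span_zero_singleton, Submodule.bot_orthogonal_eq_top]
        exact Submodule.mem_top
      rw [h1, one_mul]
      exact ⟨y, hyu, s, hs, ⟨1, by simp [unitVectors], y, hyl, by simp⟩, hdet, hinv, hy⟩
    · set u : Euc n := ‖v‖⁻¹ • v with hu
      have hv0 : ‖v‖ ≠ 0 := by simpa using hv
      have hu1 : ‖u‖ = 1 := by rw [hu, norm_smul, norm_inv, norm_norm, inv_mul_cancel₀ hv0]
      have hspan : (ℝ ∙ v) = (ℝ ∙ u) :=
        (Submodule.span_singleton_smul_eq (IsUnit.mk0 _ (inv_ne_zero hv0)) v).symm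
      have hstar : star (vec u) = -vec u := CliffordAlgebra.star_ι u
      have hvu : vec u ∈ unitary (Cliff n) := by
        rw [Unitary.mem_iff, hstar, neg_mul, mul_neg, vec_sq, hu1]
        simp
      refine ⟨vec u * y, mul_mem hvu hyu, -s, by simpa using hs,
        ⟨vec u, Or.inr ⟨u, by simpa using hu1, rfl⟩, y, hyl, rfl⟩, ?_, ?_, fun w => ?_⟩
      · have hc : (((ℝ ∙ v)ᗮ.reflection * B : OrthGroup n).toLinearEquiv : Euc n →ₗ[ℝ] Euc n)
          = ((ℝ ∙ v)ᗮ.reflection.toLinearEquiv : Euc n →ₗ[ℝ] Euc n)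
            ∘ₗ (B.toLinearEquiv : Euc n →ₗ[ℝ] Euc n) := rfl
        have hr := Submodule.det_reflection (𝕜 := ℝ) (ℝ ∙ v)ᗮ
        rw [Submodule.orthogonal_orthogonal, finrank_span_singleton hv, pow_one] at hr
        rw [hc, LinearMap.det_comp, hdet, hr]
        ring
      · rw [map_mul, CliffordAlgebra.involute_ι, hinv]
        simp
      · rw [mul_assoc, hy, mul_smul_comm, ← mul_assoc, vec_mul_vec_eq_neg_reflection hu1]
        rw [neg_mul, smul_neg, neg_smul, mul_assoc, LinearIsometryEquiv.coe_mul, Function.comp_apply]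
        simp only [hspan, hB]

-- By Cartan–Dieudonné at most `n` reflections suffice. Determinant `1` forces the sign `s` to be
-- `1`, so the implementer is even; shorter words are padded with the letter `1`.
open Pointwise in
theorem exists_spinCover_eq (A : SO n) :
    ∃ y : Spin n, spinCover n y = A ∧ (y : Cliff n) ∈ unitVectors n ^ n := by
  obtain ⟨l, hl, hA⟩ := (A : OrthGroup n).reflections_generate_dim
  obtain ⟨y, hyu, s, hs, hyl, hdet, hinv, hy⟩ := exists_unitary_implementer l
  rw [← hA] at hdet hy
  have hs1 : s = 1 := hdet.symm.trans A.2
  subst hs1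
  rw [one_smul] at hinv
  simp only [one_smul] at hy
  refine ⟨⟨⟨y, hyu⟩, hinv, fun v => ⟨(A : OrthGroup n) v, ?_⟩⟩, ?_, ?_⟩
  · rw [hy, mul_assoc, Unitary.mul_star_self_of_mem hyu, mul_one]
  · rw [spinCover_eq_iff]
    exact hy
  · rw [finrank_euclideanSpace_fin] at hl
    exact Set.pow_subset_pow_right (by simp [unitVectors]) hl hyl

theorem spinCover_surjective : Function.Surjective (spinCover n) := fun A =>
  let ⟨y, hy, _⟩ := exists_spinCover_eq A
  ⟨y, hy⟩

-- The element differs from the chosen preimage of its rotation by `1` or `-1`, which is the one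
-- extra letter in the exponent `n + 1`.
open Pointwise in
theorem spin_mem_pow_unitVectors (x : Spin n) : (x : Cliff n) ∈ unitVectors n ^ (n + 1) := by
  obtain ⟨y, hy, hyU⟩ := exists_spinCover_eq (spinCover n x)
  have h : spinCover n (x * y⁻¹) = 1 := by rw [map_mul, map_inv, hy, mul_inv_cancel]
  have hx : x = (x * y⁻¹) * y := by group
  rw [pow_succ']
  refine ⟨((x * y⁻¹ : Spin n) : Cliff n), ?_, y, hyU, ?_⟩
  · left
    rcases spinCover_eq_one_iff.1 h with h1 | h1
    · rw [h1]; simp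
    · rw [h1]; simp [spinNegOne]
  · exact (congrArg (fun x : Spin n => (x : Cliff n)) hx).symm

end SpinCover

/-! ### Topology of the spin group -/

section SpinTopology

variable {n : ℕ}

noncomputable instance : TopologicalSpace (Cliff n) := moduleTopology ℝ (Cliff n)

instance : IsModuleTopology ℝ (Cliff n) := ⟨rfl⟩

instance : IsTopologicalRing (Cliff n) := IsModuleTopology.isTopologicalRing ℝ (Cliff n)

instance : T2Space (Cliff n) := by
  let e := (Module.finBasis ℝ (Cliff n)).equivFun
  exact T2Space.of_injective_continuous e.injective
    (IsModuleTopology.continuous_of_linearMap e.toLinearMap)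

theorem continuous_vec : Continuous (vec (n := n)) :=
  LinearMap.continuous_of_finiteDimensional _

theorem continuous_star_cliff : Continuous (star : Cliff n → Cliff n) :=
  ((IsModuleTopology.continuous_of_linearMap (CliffordAlgebra.reverse (Q := negNormSq n))).comp
    (IsModuleTopology.continuous_of_linearMap
      (CliffordAlgebra.involute (Q := negNormSq n)).toLinearMap) :)

theorem isClosed_range_vec : IsClosed (Set.range (vec (n := n))) :=
  (LinearMap.range (vec (n := n))).closed_of_finiteDimensional

theorem isEmbedding_spin_coe :
    Topology.IsEmbedding (fun x : Spin n => ((x : unitary (Cliff n)) : Cliff n)) :=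
  ⟨⟨rfl⟩, spin_coe_injective⟩

theorem continuous_spin_coe :
    Continuous (fun x : Spin n => ((x : unitary (Cliff n)) : Cliff n)) :=
  isEmbedding_spin_coe.continuous

theorem isCompact_unitVectors : IsCompact (unitVectors n) :=
  ((Set.toFinite _).isCompact).union ((isCompact_sphere 0 1).image continuous_vec)

open Pointwise in
theorem isCompact_unitVectors_pow (k : ℕ) : IsCompact (unitVectors n ^ k) := by
  induction k with
  | zero => simp
  | succ k ih => rw [pow_succ]; exact ih.mul isCompact_unitVectors

theorem isClosed_range_spin_coe :
    IsClosed (Set.range (fun x : Spin n => ((x : unitary (Cliff n)) : Cliff n))) := by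
  have h : Set.range (fun x : Spin n => ((x : unitary (Cliff n)) : Cliff n)) =
      {x | star x * x = 1} ∩ {x | x * star x = 1} ∩ {x | CliffordAlgebra.involute x = x} ∩
        ⋂ v : Euc n, {x | x * vec v * star x ∈ Set.range (vec (n := n))} := by
    ext x
    constructor
    · rintro ⟨y, rfl⟩
      refine ⟨⟨⟨y.1.2.1, y.1.2.2⟩, y.2.1⟩, Set.mem_iInter.2 fun v => ?_⟩
      obtain ⟨w, hw⟩ := y.2.2 v
      exact ⟨w, hw.symm⟩
    · rintro ⟨⟨⟨h1, h2⟩, h3⟩, h4⟩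
      refine ⟨⟨⟨x, Unitary.mem_iff.2 ⟨h1, h2⟩⟩, h3, fun v => ?_⟩, rfl⟩
      obtain ⟨w, hw⟩ := Set.mem_iInter.1 h4 v
      exact ⟨w, hw.symm⟩
  have hs := continuous_star_cliff (n := n)
  have hi : Continuous (CliffordAlgebra.involute : Cliff n → Cliff n) :=
    IsModuleTopology.continuous_of_linearMap
      (CliffordAlgebra.involute (Q := negNormSq n)).toLinearMap
  rw [h]
  exact (((isClosed_eq (hs.mul continuous_id) continuous_const).inter
    (isClosed_eq (continuous_id.mul hs) continuous_const)).inter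
    (isClosed_eq hi continuous_id)).inter (isClosed_iInter fun v =>
      isClosed_range_vec.preimage ((continuous_id.mul continuous_const).mul hs))

instance : T2Space (Spin n) := isEmbedding_spin_coe.t2Space

/-- The defining conditions are closed in `C_n`, and words of bounded length in a compact alphabet
form a compact set. -/
instance : CompactSpace (Spin n) := by
  rw [← isCompact_univ_iff, isEmbedding_spin_coe.isCompact_iff, Set.image_univ]
  refine (isCompact_unitVectors_pow (n + 1)).of_isClosed_subset isClosed_range_spin_coe ?_
  rintro _ ⟨x, rfl⟩
  exact spin_mem_pow_unitVectors x

instance : IsTopologicalGroup (Spin n) where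
  continuous_mul := isEmbedding_spin_coe.continuous_iff.2
    ((continuous_spin_coe.comp continuous_fst).mul (continuous_spin_coe.comp continuous_snd))
  continuous_inv := isEmbedding_spin_coe.continuous_iff.2
    (continuous_star_cliff.comp continuous_spin_coe)

theorem isClosedEmbedding_vec : Topology.IsClosedEmbedding (vec (n := n)) :=
  LinearMap.isClosedEmbedding_of_injective (LinearMap.ker_eq_bot.2 vec_injective)

/-- Read inside `C_n`, the map is `x ↦ x v x̄`. Continuity on each vector is all that the topology
of the frame bundle asks for. -/
theorem continuous_spinCover_apply (v : Euc n) :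
    Continuous fun x : Spin n => (spinCover n x : OrthGroup n) v := by
  rw [isClosedEmbedding_vec.continuous_iff]
  have : (vec ∘ fun x : Spin n => (spinCover n x : OrthGroup n) v) =
      fun x : Spin n => (x : Cliff n) * vec v * star (x : Cliff n) := by
    funext x
    exact (spinCover_spec x v).symm
  rw [this]
  exact (continuous_spin_coe.mul continuous_const).mul
    (continuous_star_cliff.comp continuous_spin_coe)

end SpinTopology

/-! ### The flat manifold and its frame bundle -/

section Frames

variable {n : ℕ} (Γ : Subgroup (Motion n)) [IsBieberbach Γ]

theorem orbitProj_eq_iff {e e' : Euc n} :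
    orbitProj Γ e = orbitProj Γ e' ↔ ∃ γ : Γ, γ • e' = e :=
  (isQuotientCoveringMap_orbitProj Γ).apply_eq_iff_mem_orbit

theorem orbitProj_smul (γ : Γ) (e : Euc n) : orbitProj Γ (γ • e) = orbitProj Γ e :=
  (orbitProj_eq_iff Γ).2 ⟨γ, rfl⟩

theorem continuous_orbitProj : Continuous (orbitProj Γ) :=
  (isQuotientCoveringMap_orbitProj Γ).isCoveringMap.continuous

instance : CompactSpace (FlatManifold Γ) := by
  have := IsBieberbach.cocompact (Γ := Γ)
  have hrel : ∀ g h : Motion n, QuotientGroup.leftRel Γ g h →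
      orbitProj Γ (g⁻¹ • (0 : Euc n)) = orbitProj Γ (h⁻¹ • (0 : Euc n)) := by
    intro g h hgh
    rw [QuotientGroup.leftRel_apply] at hgh
    refine (orbitProj_eq_iff Γ).2 ⟨⟨_, hgh⟩, ?_⟩
    change (g⁻¹ * h) • h⁻¹ • (0 : Euc n) = g⁻¹ • (0 : Euc n)
    rw [← mul_smul, mul_assoc, mul_inv_cancel, mul_one]
  -- Cosets identify `g` with `gγ`, whereas orbits are taken under `Γ` from the left; hence `g` is
  -- sent to `π(g⁻¹ 0)`. Translations give surjectivity.
  let F : Motion n ⧸ Γ → FlatManifold Γ := Quotient.lift _ hrel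
  have hF : Continuous F := by
    refine Continuous.quotient_lift ?_ hrel
    have hc : Continuous (motionPair (n := n)) := continuous_induced_dom
    exact (continuous_orbitProj Γ).comp (hc.comp continuous_inv).snd
  suffices h : Function.Surjective F from h.compactSpace hF
  intro x
  obtain ⟨e, rfl⟩ := (isQuotientCoveringMap_orbitProj Γ).surjective x
  refine ⟨QuotientGroup.mk (AffineIsometryEquiv.constVAdd ℝ (Euc n) e)⁻¹, ?_⟩
  change orbitProj Γ ((AffineIsometryEquiv.constVAdd ℝ (Euc n) e)⁻¹⁻¹ • (0 : Euc n)) = _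
  rw [inv_inv, motion_smul_def, AffineIsometryEquiv.coe_constVAdd]
  exact congrArg (orbitProj Γ) (add_zero e)

/-- The derivative of the projection `ℝⁿ → ℝⁿ/Γ`, with the tangent spaces identified with `ℝⁿ`
by the charts. -/
noncomputable def dproj (e : Euc n) : Euc n →L[ℝ] TangentSpace 𝓘(ℝ, Euc n) (orbitProj Γ e) :=
  mfderiv 𝓘(ℝ, Euc n) 𝓘(ℝ, Euc n) (orbitProj Γ) e

theorem mfderiv_motion (g : Motion n) (e : Euc n) :
    HasMFDerivAt 𝓘(ℝ, Euc n) 𝓘(ℝ, Euc n) (fun z => g z) e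
      ((rot n g : OrthGroup n) : Euc n →L[ℝ] Euc n) := by
  have h : (fun z => g z) = fun z => (rot n g : Euc n →L[ℝ] Euc n) z + g 0 :=
    funext fun z => motion_apply g z
  refine HasFDerivAt.hasMFDerivAt ?_
  rw [h]
  exact (ContinuousLinearMap.hasFDerivAt (rot n g : Euc n →L[ℝ] Euc n)).add_const _

theorem hasMFDerivAt_orbitProj (e : Euc n) :
    HasMFDerivAt 𝓘(ℝ, Euc n) 𝓘(ℝ, Euc n) (orbitProj Γ) e (dproj Γ e) :=
  ((contMDiff_orbitProj Γ 1).mdifferentiable one_ne_zero e).hasMFDerivAt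

/-- In a chart the projection is locally some `γ ∈ Γ`, so by the chain rule `dπ_e` followed by the
derivative of the chart is the invertible map `r(γ)`. -/
theorem dproj_injective (e : Euc n) : Function.Injective (dproj Γ e) := by
  set c := chartAt (Euc n) (orbitProj Γ e) with hc
  have hcont := continuous_orbitProj Γ
  have hes : c.source ∈ 𝓝 (orbitProj Γ e) := c.open_source.mem_nhds (mem_chart_source _ _)
  obtain ⟨γ, hγ⟩ := eventuallyEq_smul Γ (τ := c ∘ orbitProj Γ) (y := e)
    ((c.continuousAt (mem_chart_source _ _)).comp hcont.continuousAt) (by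
      filter_upwards [hcont.continuousAt hes] with z hz
      rw [Function.comp_apply, ← coe_symm_of_mem_atlas (chart_mem_atlas _ (orbitProj Γ e)),
        ← hc, c.left_inv hz])
  have h1 : MDifferentiableAt 𝓘(ℝ, Euc n) 𝓘(ℝ, Euc n) c (orbitProj Γ e) :=
    mdifferentiableAt_atlas (chart_mem_atlas _ _) (mem_chart_source _ _)
  have h2 := h1.hasMFDerivAt.comp e (hasMFDerivAt_orbitProj Γ e)
  have h3 := (mfderiv_motion (γ : Motion n) e).congr_of_eventuallyEq hγ
  have h4 := hasMFDerivAt_unique h2 h3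
  intro v w hvw
  have h5 : ∀ v, (rot n (γ : Motion n) : OrthGroup n) v =
      mfderiv 𝓘(ℝ, Euc n) 𝓘(ℝ, Euc n) c (orbitProj Γ e) (dproj Γ e v) := fun v =>
    (congrArg (fun T : Euc n →L[ℝ] Euc n => T v) h4).symm
  apply (rot n (γ : Motion n)).injective
  rw [h5, h5, hvw]

/-- The oriented frame `dπ_e ∘ A` of `ℝⁿ/Γ`. -/
noncomputable def frame (e : Euc n) (A : SO n) : FrameBundle Γ :=
  ⟨⟨orbitProj Γ e, (dproj Γ e).comp ((A : OrthGroup n) : Euc n →L[ℝ] Euc n)⟩, e, A, rfl⟩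

theorem frame_act (e : Euc n) (A B : SO n) : (frame Γ e A).act B = frame Γ e (A * B) := rfl

theorem frame_proj (e : Euc n) (A : SO n) : (frame Γ e A).proj = orbitProj Γ e := rfl

theorem exists_frame_eq (F : FrameBundle Γ) : ∃ e A, frame Γ e A = F := by
  obtain ⟨F, e, A, h⟩ := F
  exact ⟨e, A, Subtype.ext h.symm⟩

theorem clm_ext_single {E : Type*} [AddCommGroup E] [Module ℝ E] [TopologicalSpace E]
    {f f' : Euc n →L[ℝ] E}
    (h : ∀ i, f (EuclideanSpace.single i 1) = f' (EuclideanSpace.single i 1)) : f = f' := by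
  apply ContinuousLinearMap.coe_injective
  refine (EuclideanSpace.basisFun (Fin n) ℝ).toBasis.ext fun i => ?_
  simpa using h i

variable {Γ} in
theorem frameBundle_ext {F F' : FrameBundle Γ} (h : F.proj = F'.proj)
    (hv : ∀ i, F.vector i = F'.vector i) : F = F' := by
  obtain ⟨⟨x, f⟩, hF⟩ := F
  obtain ⟨⟨x', f'⟩, hF'⟩ := F'
  change x = x' at h
  subst h
  have h1 : f = f' := clm_ext_single fun i => eq_of_heq (Bundle.TotalSpace.mk.inj (hv i)).2
  subst h1
  rfl

/-- Differentiate `π ∘ γ = π`. The tangent spaces at `π(γe)` and `π(e)` are both `ℝⁿ` by definition,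
so the equation is stated there and no transport is needed. -/
theorem dproj_smul (γ : Γ) (e v : Euc n) :
    (dproj Γ (γ • e) (rot n (γ : Motion n) v) : Euc n) = dproj Γ e v := by
  have h1 := (hasMFDerivAt_orbitProj Γ (γ • e)).comp e (mfderiv_motion (γ : Motion n) e)
  have h2 := (hasMFDerivAt_orbitProj Γ e).congr_of_eventuallyEq
    (f₁ := orbitProj Γ ∘ fun z => (γ : Motion n) z)
    (Filter.Eventually.of_forall fun z => orbitProj_smul Γ γ z)
  exact congrArg (fun T : Euc n →L[ℝ] Euc n => T v) (hasMFDerivAt_unique h1 h2)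

theorem frame_smul (γ : Γ) (e : Euc n) (A B : SO n)
    (hB : (B : OrthGroup n) = rot n γ) : frame Γ (γ • e) (B * A) = frame Γ e A := by
  refine frameBundle_ext (orbitProj_smul Γ γ e) fun i => ?_
  refine Bundle.TotalSpace.ext (orbitProj_smul Γ γ e) (heq_of_eq ?_)
  have h := dproj_smul Γ γ e ((A : OrthGroup n) (EuclideanSpace.single i 1))
  rw [← hB] at h
  exact h

theorem frame_injective (e : Euc n) : Function.Injective (frame Γ e) := by
  intro A B h
  have h1 : (dproj Γ e).comp ((A : OrthGroup n) : Euc n →L[ℝ] Euc n)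
      = (dproj Γ e).comp ((B : OrthGroup n) : Euc n →L[ℝ] Euc n) :=
    eq_of_heq (Sigma.mk.inj (congrArg Subtype.val h)).2
  ext1
  ext1 v
  apply dproj_injective Γ e
  exact congrArg (fun T : Euc n →L[ℝ] Euc n => T v) h1

theorem frame_vector (e : Euc n) (A : SO n) (i : Fin n) :
    (frame Γ e A).vector i = tangentMap 𝓘(ℝ, Euc n) 𝓘(ℝ, Euc n) (orbitProj Γ)
      ⟨e, (A : OrthGroup n) (EuclideanSpace.single i 1)⟩ := rfl

/-- The vectors of the frame are images under the tangent map of `π`. Rotations are parametrised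
through `λ_n`, so only the topology of `Spin(n)` enters. -/
theorem continuous_frame : Continuous fun p : Euc n × Spin n => frame Γ p.1 (spinCover n p.2) := by
  rw [continuous_induced_rng]
  refine ((continuous_orbitProj Γ).comp continuous_fst).prodMk (continuous_pi fun i => ?_)
  have h := (contMDiff_orbitProj Γ 1).continuous_tangentMap le_rfl
  have h2 := (tangentBundleModelSpaceHomeomorph 𝓘(ℝ, Euc n)).symm.continuous
  have h3 : Continuous fun p : Euc n × Spin n =>
      (p.1, (spinCover n p.2 : OrthGroup n) (EuclideanSpace.single i 1)) :=
    continuous_fst.prodMk ((continuous_spinCover_apply _).comp continuous_snd)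
  have h4 : (fun p : Euc n × Spin n => (frame Γ p.1 (spinCover n p.2)).vector i) =
      fun p => tangentMap 𝓘(ℝ, Euc n) 𝓘(ℝ, Euc n) (orbitProj Γ)
        ((tangentBundleModelSpaceHomeomorph 𝓘(ℝ, Euc n)).symm
          ((p.1, (spinCover n p.2 : OrthGroup n) (EuclideanSpace.single i 1)) :
            ModelProd (Euc n) (Euc n))) := by
    funext p
    rw [frame_vector]
    rfl
  change Continuous (fun p : Euc n × Spin n => (frame Γ p.1 (spinCover n p.2)).vector i)
  rw [h4]
  exact h.comp (h2.comp h3)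

/-- Points of one fibre are separated in a trivialization, points of different fibres by their base
points. This makes the frame bundle Hausdorff. -/
instance : T2Space (TangentBundle 𝓘(ℝ, Euc n) (FlatManifold Γ)) := by
  refine ⟨fun p q hpq => ?_⟩
  have hc : Continuous (Bundle.TotalSpace.proj :
      TangentBundle 𝓘(ℝ, Euc n) (FlatManifold Γ) → FlatManifold Γ) :=
    FiberBundle.continuous_proj _ _
  by_cases hx : p.proj = q.proj
  · set t := trivializationAt (Euc n) (TangentSpace 𝓘(ℝ, Euc n)) p.proj
    have hp : p ∈ t.source := t.mem_source.2 (FiberBundle.mem_baseSet_trivializationAt' _)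
    have hq : q ∈ t.source :=
      t.mem_source.2 (hx ▸ FiberBundle.mem_baseSet_trivializationAt' p.proj)
    have hne : t p ≠ t q := fun h => hpq (t.injOn hp hq h)
    obtain ⟨U, V, hU, hV, hpU, hqV, hd⟩ := t2_separation hne
    refine ⟨_, _, t.continuousOn.isOpen_inter_preimage t.open_source hU,
      t.continuousOn.isOpen_inter_preimage t.open_source hV, ⟨hp, hpU⟩, ⟨hq, hqV⟩, ?_⟩
    exact (hd.preimage t).mono Set.inter_subset_right Set.inter_subset_right
  · obtain ⟨U, V, hU, hV, hpU, hqV, hd⟩ := t2_separation hx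
    exact ⟨_, _, hU.preimage hc, hV.preimage hc, hpU, hqV, hd.preimage _⟩

instance : T2Space (FrameBundle Γ) :=
  T2Space.of_injective_continuous
    (f := fun F : FrameBundle Γ => (F.proj, fun i => F.vector i))
    (fun _ _ h => frameBundle_ext (Prod.ext_iff.1 h).1
      fun i => congrFun (Prod.ext_iff.1 h).2 i) continuous_induced_dom

end Frames

/-! ### The spin structure of a lift of the holonomy representation -/

section FromHom

variable {n : ℕ} {Γ : Subgroup (Motion n)}

/-- The space `ℝⁿ × Spin(n)` on which `Γ` acts by `γ (e, g) = (γ e, ε(γ) g)`. -/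
def TrivialCover (_ε : Γ →* Spin n) : Type := Euc n × Spin n

variable (ε : Γ →* Spin n)

noncomputable instance : TopologicalSpace (TrivialCover ε) :=
  inferInstanceAs (TopologicalSpace (Euc n × Spin n))

instance : T2Space (TrivialCover ε) := inferInstanceAs (T2Space (Euc n × Spin n))

instance : LocallyCompactSpace (TrivialCover ε) :=
  inferInstanceAs (LocallyCompactSpace (Euc n × Spin n))

noncomputable instance : MulAction Γ (TrivialCover ε) where
  smul γ p := (γ • p.1, ε γ * p.2)
  one_smul p := Prod.ext (one_smul Γ p.1) (by change ε 1 * p.2 = p.2; rw [map_one, one_mul])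
  mul_smul γ δ p := Prod.ext (mul_smul γ δ p.1)
    (by change ε (γ * δ) * p.2 = ε γ * (ε δ * p.2); rw [map_mul, mul_assoc])

instance : ContinuousConstSMul Γ (TrivialCover ε) where
  continuous_const_smul γ :=
    (((continuous_const_smul γ).comp continuous_fst).prodMk
      (continuous_const.mul continuous_snd) :
      Continuous fun p : Euc n × Spin n => (γ • p.1, ε γ * p.2))

instance [IsBieberbach Γ] : ProperlyDiscontinuousSMul Γ (TrivialCover ε) where
  finite_disjoint_inter_image {K L} hK hL := by
    have hc : Continuous (Prod.fst : Euc n × Spin n → Euc n) := continuous_fst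
    refine (ProperlyDiscontinuousSMul.finite_disjoint_inter_image (Γ := Γ)
      (hK.image hc) (hL.image hc)).subset ?_
    rintro γ ⟨_, ⟨p, hp, rfl⟩, hq⟩
    exact ⟨γ • p.1, ⟨p.1, ⟨p, hp, rfl⟩, rfl⟩, ⟨_, hq, rfl⟩⟩

instance [IsBieberbach Γ] : IsCancelSMul Γ (TrivialCover ε) := by
  rw [isCancelSMul_iff_eq_one_of_smul_eq]
  intro γ p h
  exact isCancelSMul_iff_eq_one_of_smul_eq.1 inferInstance γ p.1 (congrArg Prod.fst h)

/-- The total space `(ℝⁿ × Spin(n))/Γ`. -/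
abbrev Total : Type := Quotient (MulAction.orbitRel Γ (TrivialCover ε))

/-- The class of `(e, g)` in the total space. -/
noncomputable def Total.mk (e : Euc n) (g : Spin n) : Total ε := Quotient.mk _ (e, g)

namespace Total

variable {ε}

theorem exists_mk_eq (p : Total ε) : ∃ e g, mk ε e g = p := by
  induction p using Quotient.inductionOn with
  | h p => exact ⟨p.1, p.2, rfl⟩

/-- A map on `ℝⁿ × Spin(n)` that is invariant under `Γ` descends to the total space. -/
noncomputable def lift {α : Type*} (f : Euc n → Spin n → α) (hf : ∀ (γ : Γ) e g, f (γ • e) (ε γ * g) = f e g) :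
    Total ε → α :=
  Quotient.lift (fun p : TrivialCover ε => f p.1 p.2) (by
    rintro p q ⟨γ, rfl⟩
    exact hf γ q.1 q.2)

end Total

variable [IsBieberbach Γ]

theorem isQuotientCoveringMap_mk : IsQuotientCoveringMap
    (Quotient.mk (MulAction.orbitRel Γ (TrivialCover ε))) Γ :=
  isQuotientCoveringMap_quotientMk_of_properlyDiscontinuousSMul

namespace Total

variable {ε}

theorem mk_eq_iff {e e' : Euc n} {g g' : Spin n} :
    mk ε e g = mk ε e' g' ↔ ∃ γ : Γ, γ • e' = e ∧ ε γ * g' = g := by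
  refine (isQuotientCoveringMap_mk ε).apply_eq_iff_mem_orbit.trans ⟨?_, ?_⟩
  · rintro ⟨γ, hγ⟩
    exact ⟨γ, congrArg Prod.fst hγ, congrArg Prod.snd hγ⟩
  · rintro ⟨γ, h1, h2⟩
    exact ⟨γ, Prod.ext h1 h2⟩

theorem mk_smul (γ : Γ) (e : Euc n) (g : Spin n) : mk ε (γ • e) (ε γ * g) = mk ε e g :=
  mk_eq_iff.2 ⟨γ, rfl, rfl⟩

theorem isOpenQuotientMap_mk :
    IsOpenQuotientMap (fun p : Euc n × Spin n => mk ε p.1 p.2) :=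
  (isQuotientCoveringMap_mk ε).isOpenQuotientMap

theorem continuous_lift {α : Type*} [TopologicalSpace α] {f : Euc n → Spin n → α}
    {hf : ∀ (γ : Γ) e g, f (γ • e) (ε γ * g) = f e g}
    (hc : Continuous fun p : Euc n × Spin n => f p.1 p.2) : Continuous (lift f hf) :=
  isOpenQuotientMap_mk.continuous_comp_iff.1 hc

variable (ε) in
/-- The projection to `ℝⁿ/Γ`. -/
noncomputable def proj : Total ε → FlatManifold Γ :=
  lift (fun e _ => orbitProj Γ e) fun γ e _ => orbitProj_smul Γ γ e

/-- The right action of `Spin(n)`. -/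
noncomputable def act (p : Total ε) (h : Spin n) : Total ε :=
  lift (fun e g => mk ε e (g * h)) (fun γ e g => by rw [mul_assoc, mk_smul]) p

theorem act_mk (e : Euc n) (g h : Spin n) : act (mk ε e g) h = mk ε e (g * h) := rfl

theorem continuous_act : Continuous fun p : Total ε × Spin n => act p.1 p.2 := by
  refine ((isOpenQuotientMap_mk (ε := ε)).prodMap
    (IsOpenQuotientMap.id (X := Spin n))).continuous_comp_iff.1 ?_
  have h : Continuous fun p : (Euc n × Spin n) × Spin n => (p.1.1, p.1.2 * p.2) :=
    (continuous_fst.comp continuous_fst).prodMk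
      ((continuous_snd.comp continuous_fst).mul continuous_snd)
  exact (isOpenQuotientMap_mk (ε := ε)).continuous.comp h

instance : CompactSpace (Total ε) := by
  -- The images of the balls form an increasing open cover of the compact space `X`, so a single
  -- ball maps onto `X`.
  obtain ⟨R, hR⟩ : ∃ R : ℕ, Set.univ ⊆ orbitProj Γ '' Metric.ball 0 (R : ℝ) := by
    refine isCompact_univ.elim_directed_cover _
      (fun R : ℕ => (isQuotientCoveringMap_orbitProj Γ).isOpenQuotientMap.isOpenMap _
        (Metric.isOpen_ball (x := 0) (ε := (R : ℝ)))) ?_ ?_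
    · intro x _
      obtain ⟨e, rfl⟩ := (isQuotientCoveringMap_orbitProj Γ).surjective x
      obtain ⟨R, hR⟩ := exists_nat_gt ‖e‖
      exact Set.mem_iUnion.2 ⟨R, e, by simpa using hR, rfl⟩
    · exact Monotone.directed_le fun R S h =>
        Set.image_mono (Metric.ball_subset_ball (Nat.cast_le.2 h))
  have hK : IsCompact (Metric.closedBall (0 : Euc n) (R : ℝ) ×ˢ (Set.univ : Set (Spin n))) :=
    (isCompact_closedBall _ _).prod isCompact_univ
  have h := hK.image (isOpenQuotientMap_mk (ε := ε)).continuous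
  refine ⟨h.of_isClosed_subset isClosed_univ ?_⟩
  intro p _
  obtain ⟨e, g, rfl⟩ := exists_mk_eq p
  obtain ⟨e', he', h'⟩ := hR (Set.mem_univ (orbitProj Γ e))
  obtain ⟨γ, hγ⟩ := (orbitProj_eq_iff Γ).1 h'
  refine ⟨(e', ε γ * g), ⟨Metric.ball_subset_closedBall he', Set.mem_univ _⟩, ?_⟩
  change mk ε e' (ε γ * g) = _
  rw [← hγ, mk_smul]

/-- Over an open `V` that meets none of its translates by `γ ≠ 1`, both `π` on `V` and `mk` on `V ×
Spin(n)` are injective open maps. Inverting the latter and applying `π × id` trivializes, and the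
right action never touches the first factor. -/
theorem exists_trivialization (x : FlatManifold Γ) :
    ∃ t : Bundle.Trivialization (Spin n) (proj ε), x ∈ t.baseSet ∧
      ∀ p g, proj ε p ∈ t.baseSet → (t (act p g)).2 = (t p).2 * g := by
  obtain ⟨e, rfl⟩ := (isQuotientCoveringMap_orbitProj Γ).surjective x
  obtain ⟨U, hU, hdis⟩ := (isQuotientCoveringMap_orbitProj Γ).disjoint e
  obtain ⟨V, hVU, hV, heV⟩ := mem_nhds_iff.1 hU
  have hinj : ∀ (γ : Γ) (v : Euc n), v ∈ V → γ • v ∈ V → γ = 1 := fun γ v h1 h2 =>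
    hdis γ ⟨γ • v, ⟨v, hVU h1, rfl⟩, hVU h2⟩
  have hπ : Set.InjOn (orbitProj Γ) V := by
    intro v hv w hw hvw
    obtain ⟨γ, rfl⟩ := (orbitProj_eq_iff Γ).1 hvw
    rw [hinj γ w hw hv, one_smul]
  have hΦ : Set.InjOn (fun p : Euc n × Spin n => mk ε p.1 p.2) (V ×ˢ Set.univ) := by
    rintro ⟨v, g⟩ ⟨hv, -⟩ ⟨w, h⟩ ⟨hw, -⟩ hvw
    obtain ⟨γ, rfl, rfl⟩ := mk_eq_iff.1 hvw
    rw [hinj γ w hw hv, one_smul, map_one, one_mul]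
  let Ψ : OpenPartialHomeomorph (Euc n × Spin n) (FlatManifold Γ × Spin n) :=
    (OpenPartialHomeomorph.ofContinuousOpen (hπ.bijOn_image.toPartialEquiv _ _ _)
      (continuous_orbitProj Γ).continuousOn
      (isQuotientCoveringMap_orbitProj Γ).isOpenQuotientMap.isOpenMap hV).prod
      (OpenPartialHomeomorph.refl (Spin n))
  let Φ : OpenPartialHomeomorph (Euc n × Spin n) (Total ε) :=
    OpenPartialHomeomorph.ofContinuousOpen (hΦ.bijOn_image.toPartialEquiv _ _ _)
      isOpenQuotientMap_mk.continuous.continuousOn isOpenQuotientMap_mk.isOpenMap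
      (hV.prod isOpen_univ)
  have hsource : Φ.target = proj ε ⁻¹' (orbitProj Γ '' V) := by
    ext p
    constructor
    · rintro ⟨⟨v, g⟩, ⟨hv, -⟩, rfl⟩
      exact ⟨v, hv, rfl⟩
    · rintro ⟨v, hv, h⟩
      obtain ⟨w, g, rfl⟩ := exists_mk_eq p
      obtain ⟨γ, rfl⟩ := (orbitProj_eq_iff Γ).1 h
      exact ⟨(γ • w, ε γ * g), ⟨hv, Set.mem_univ _⟩, mk_smul γ w g⟩
  have hΦmk : ∀ v ∈ V, ∀ g, Φ.symm (mk ε v g) = (v, g) := fun v hv g =>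
    Φ.left_inv (x := (v, g)) ⟨hv, Set.mem_univ _⟩
  let T := Φ.symm.trans' Ψ rfl
  have hT : ∀ v ∈ V, ∀ g, T (mk ε v g) = (orbitProj Γ v, g) := fun v hv g =>
    congrArg Ψ (hΦmk v hv g)
  have hmem : ∀ p ∈ proj ε ⁻¹' (orbitProj Γ '' V), ∃ v ∈ V, ∃ g, mk ε v g = p := by
    intro p hp
    rw [← hsource] at hp
    obtain ⟨⟨v, g⟩, ⟨hv, -⟩, rfl⟩ := hp
    exact ⟨v, hv, g, rfl⟩
  refine ⟨{ T with
    baseSet := orbitProj Γ '' V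
    open_baseSet := (isQuotientCoveringMap_orbitProj Γ).isOpenQuotientMap.isOpenMap _ hV
    source_eq := hsource
    target_eq := rfl
    proj_toFun := fun p hp => ?_ }, ⟨e, heV, rfl⟩, fun p g hp => ?_⟩
  · obtain ⟨v, hv, g, rfl⟩ := hmem p (hsource ▸ hp)
    exact congrArg Prod.fst (hT v hv g)
  · obtain ⟨v, hv, h, rfl⟩ := hmem p hp
    change (T (mk ε v (h * g))).2 = (T (mk ε v h)).2 * g
    rw [hT v hv, hT v hv]

variable (hε : ∀ γ : Γ, (spinCover n (ε γ) : OrthGroup n) = rot n γ)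

/-- The map to the frame bundle, `[e, g] ↦ dπ_e ∘ λ_n(g)`. -/
noncomputable def lam : Total ε → FrameBundle Γ :=
  lift (fun e g => frame Γ e (spinCover n g)) fun γ e g => by
    rw [map_mul, frame_smul Γ γ e _ _ (hε γ)]

theorem lam_mk (e : Euc n) (g : Spin n) : lam hε (mk ε e g) = frame Γ e (spinCover n g) := rfl

theorem continuous_lam : Continuous (lam hε) := continuous_lift (continuous_frame Γ)

theorem lam_surjective : Function.Surjective (lam hε) := by
  intro F
  obtain ⟨e, A, rfl⟩ := exists_frame_eq Γ F
  obtain ⟨g, rfl⟩ := spinCover_surjective A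
  exact ⟨mk ε e g, rfl⟩

theorem lam_act (p : Total ε) (g : Spin n) : lam hε (act p g) = (lam hε p).act (spinCover n g) := by
  obtain ⟨e, h, rfl⟩ := exists_mk_eq p
  rw [act_mk, lam_mk, lam_mk, frame_act, map_mul]

theorem lam_act_of_mem_ker {p : Total ε} {c : Spin n} (hc : spinCover n c = 1) :
    lam hε (act p c) = lam hε p := by
  rw [lam_act, hc]
  rfl

/-- `Γ` acts freely on `ℝⁿ`, so a fixed class can only come from `γ = 1`. -/
theorem act_eq_self_iff {p : Total ε} {g : Spin n} : act p g = p ↔ g = 1 := by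
  obtain ⟨e, h, rfl⟩ := exists_mk_eq p
  rw [act_mk, mk_eq_iff]
  constructor
  · rintro ⟨γ, h1, h2⟩
    have h3 := isCancelSMul_iff_eq_one_of_smul_eq.1 inferInstance γ e h1
    rw [h3, map_one, one_mul] at h2
    exact left_eq_mul.1 h2
  · rintro rfl
    exact ⟨1, by simp, by simp⟩

/-- Representatives can be chosen over the same `e`, where `dπ_e` is injective and the frame
determines `λ_n(g)`. -/
theorem exists_act_of_lam_eq {p q : Total ε} (h : lam hε p = lam hε q) :
    ∃ c, spinCover n c = 1 ∧ act q c = p := by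
  obtain ⟨e, g, rfl⟩ := exists_mk_eq p
  obtain ⟨e', g', rfl⟩ := exists_mk_eq q
  obtain ⟨γ, rfl⟩ := (orbitProj_eq_iff Γ).1 (congrArg FrameBundle.proj h)
  rw [← mk_smul γ e' g'] at h ⊢
  rw [lam_mk, lam_mk] at h
  refine ⟨(ε γ * g')⁻¹ * g, ?_, by rw [act_mk, mul_inv_cancel_left]⟩
  rw [map_mul, map_inv, frame_injective Γ _ h, inv_mul_cancel]

/-- The action of the kernel of `λ_n` on the total space. -/
noncomputable abbrev kerAction (ε : Γ →* Spin n) : MulAction (spinCover n).ker (Total ε) where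
  smul c p := act p (c⁻¹ : (spinCover n).ker)
  one_smul p := by
    change act p _ = p
    rw [act_eq_self_iff]
    simp
  mul_smul c d p := by
    obtain ⟨e, g, rfl⟩ := exists_mk_eq p
    change mk ε e _ = mk ε e _
    simp [mul_assoc]

/-- A continuous surjection from a compact space to a Hausdorff space is a quotient map, and its
fibres here are the orbits of the finite group `ker λ_n`, which acts freely. -/
theorem isQuotientCoveringMap_lam :
    letI := kerAction ε
    IsQuotientCoveringMap (lam hε) (spinCover n).ker := by
  let := kerAction ε
  have hc : ContinuousConstSMul (spinCover n).ker (Total ε) :=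
    ⟨fun c => continuous_act.comp (continuous_id.prodMk continuous_const)⟩
  have hcancel : IsCancelSMul (spinCover n).ker (Total ε) := by
    rw [isCancelSMul_iff_eq_one_of_smul_eq]
    intro c p h
    have h1 := act_eq_self_iff.1 h
    rw [← inv_eq_one]
    exact Subtype.ext h1
  have hq : Topology.IsQuotientMap (lam hε) := (continuous_lam hε).isClosedMap.isQuotientMap
    (continuous_lam hε) (lam_surjective hε)
  refine hq.isQuotientCoveringMap_of_properlyDiscontinuousSMul ⟨fun h => ?_, ?_⟩
  · obtain ⟨c, hc, h⟩ := exists_act_of_lam_eq hε h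
    refine ⟨(⟨c, hc⟩ : (spinCover n).ker)⁻¹, ?_⟩
    change act _ _ = _
    rwa [inv_inv]
  · rintro ⟨c, rfl⟩
    exact lam_act_of_mem_ker hε (c⁻¹).2

end Total

/-- The spin structure on `ℝⁿ/Γ` given by a lift `ε` of the holonomy representation. -/
noncomputable def spinStructureOfHom
    (hε : ∀ γ : Γ, (spinCover n (ε γ) : OrthGroup n) = rot n γ) : SpinStructure Γ where
  P := Total ε
  proj := Total.proj ε
  act := Total.act
  act_one p := Total.act_eq_self_iff.2 rfl
  act_mul p g h := by
    obtain ⟨e, k, rfl⟩ := Total.exists_mk_eq p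
    rw [Total.act_mk, Total.act_mk, Total.act_mk, mul_assoc]
  continuous_act := Total.continuous_act
  proj_act p g := by
    obtain ⟨e, k, rfl⟩ := Total.exists_mk_eq p
    rfl
  locally_trivial := Total.exists_trivialization
  lam := Total.lam hε
  isCoveringMap_lam :=
    letI := Total.kerAction ε
    (Total.isQuotientCoveringMap_lam hε).isCoveringMap
  two_fold q := by
    let := Total.kerAction ε
    obtain ⟨p, hp⟩ := Total.lam_surjective hε q
    rw [← Nat.card_coe_set_eq,
      Nat.card_congr ((Total.isQuotientCoveringMap_lam hε).fiberEquivGroup ⟨p, hp⟩),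
      card_ker_spinCover]
  proj_lam p := by
    obtain ⟨e, k, rfl⟩ := Total.exists_mk_eq p
    rfl
  lam_act := Total.lam_act hε

end FromHom

/-! ### The lift of the holonomy representation given by a spin structure -/

namespace SpinStructure

variable {n : ℕ} {Γ : Subgroup (Motion n)} [IsBieberbach Γ] (σ : SpinStructure Γ)

theorem act_injective (p : σ.P) : Function.Injective (σ.act p) := by
  intro g h hgh
  obtain ⟨t, ht, hact⟩ := σ.locally_trivial (σ.proj p)
  have h1 := hact p g ht
  rw [hgh, hact p h ht] at h1
  exact (mul_left_cancel h1).symm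

theorem exists_act_eq {p q : σ.P} (h : σ.proj p = σ.proj q) : ∃ g, σ.act p g = q := by
  obtain ⟨t, ht, hact⟩ := σ.locally_trivial (σ.proj p)
  have h1 : σ.proj (σ.act p ((t p).2⁻¹ * (t q).2)) ∈ t.baseSet := by rwa [σ.proj_act]
  have h2 : σ.proj q ∈ t.baseSet := h ▸ ht
  refine ⟨(t p).2⁻¹ * (t q).2, t.injOn (t.mem_source.2 h1) (t.mem_source.2 h2) ?_⟩
  change t _ = t _
  refine Prod.ext ?_ ?_
  · rw [t.coe_fst' h1, t.coe_fst' h2, σ.proj_act, h]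
  · rw [hact p _ ht, mul_inv_cancel_left]

theorem lam_surjective : Function.Surjective σ.lam := by
  intro q
  have h : (σ.lam ⁻¹' {q}).Nonempty :=
    Set.nonempty_of_ncard_ne_zero (by rw [σ.two_fold]; norm_num)
  exact h

theorem continuous_act_right (g : Spin n) : Continuous fun p => σ.act p g :=
  σ.continuous_act.comp (continuous_id.prodMk continuous_const)

/-- A covering map is separated and its base `Q` is Hausdorff. -/
instance : T2Space σ.P := by
  refine ⟨fun p q hpq => ?_⟩
  by_cases h : σ.lam p = σ.lam q
  · exact σ.isCoveringMap_lam.isSeparatedMap p q h hpq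
  · obtain ⟨U, V, hU, hV, hpU, hqV, hd⟩ := t2_separation h
    have hc := σ.isCoveringMap_lam.continuous
    exact ⟨_, _, hU.preimage hc, hV.preimage hc, hpU, hqV, hd.preimage _⟩

/-- A lift to `P` of the global frame `e ↦ dπ_e` along `ℝⁿ → ℝⁿ/Γ`. -/
structure IsFrameLift (s : Euc n → σ.P) : Prop where
  continuous : Continuous s
  lam_eq : ∀ e, σ.lam (s e) = frame Γ e 1

theorem continuous_frame_one : Continuous fun e => frame Γ e 1 := by
  have h := (continuous_frame Γ).comp
    (continuous_id.prodMk (continuous_const (y := (1 : Spin n))))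
  simpa [Function.comp_def] using h

/-- `ℝⁿ` is simply connected, so the tautological frame lifts through the covering `Λ`. -/
theorem exists_isFrameLift : ∃ s, σ.IsFrameLift s := by
  obtain ⟨p, hp⟩ := σ.lam_surjective (frame Γ 0 1)
  obtain ⟨F, ⟨-, hF⟩, -⟩ := σ.isCoveringMap_lam.existsUnique_continuousMap_lifts
    ⟨_, continuous_frame_one⟩ 0 p hp
  exact ⟨F, F.continuous, fun e => congrFun hF e⟩

variable {σ}

theorem IsFrameLift.proj_eq {s : Euc n → σ.P} (hs : σ.IsFrameLift s) (e : Euc n) :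
    σ.proj (s e) = orbitProj Γ e := by
  rw [← σ.proj_lam, hs.lam_eq, frame_proj]

theorem IsFrameLift.lam_act {s : Euc n → σ.P} (hs : σ.IsFrameLift s) (e : Euc n) (g : Spin n) :
    σ.lam (σ.act (s e) g) = frame Γ e (spinCover n g) := by
  rw [σ.lam_act, hs.lam_eq, frame_act, one_mul]

/-- Lifts of the global frame differ by elements of the kernel of `λ_n`. -/
theorem IsFrameLift.exists_eq_act {s t : Euc n → σ.P} (hs : σ.IsFrameLift s)
    (ht : σ.IsFrameLift t) : ∃ c, spinCover n c = 1 ∧ ∀ e, t e = σ.act (s e) c := by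
  obtain ⟨c, hc⟩ := σ.exists_act_eq (p := s 0) (q := t 0) (by rw [hs.proj_eq, ht.proj_eq])
  have hc1 : spinCover n c = 1 := by
    apply frame_injective Γ 0
    rw [← hs.lam_act, hc, ht.lam_eq]
  -- The element found at the origin works everywhere: `t` and `s · c` lift the same map from a
  -- connected space and agree at `0`.
  refine ⟨c, hc1, congrFun (σ.isCoveringMap_lam.eq_of_comp_eq ht.continuous
    ((σ.continuous_act_right c).comp hs.continuous) (funext fun e => ?_) 0 hc.symm)⟩
  change σ.lam (t e) = σ.lam (σ.act (s e) c)
  rw [ht.lam_eq, hs.lam_act, hc1]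

/-- Both `e ↦ s(γe)` and `e ↦ s(e) h` lift `e ↦ dπ_{γe} = dπ_e ∘ r(γ)⁻¹`, so agreement at `0` gives
agreement everywhere. As `h` lies over `r(γ)⁻¹`, the lift of `r(γ)` is `h⁻¹`. -/
theorem IsFrameLift.exists_smul_eq {s : Euc n → σ.P} (hs : σ.IsFrameLift s) {γ : Γ}
    (hγ : rot n (γ : Motion n) ∈ SO n) :
    ∃ g, (spinCover n g : OrthGroup n) = rot n γ ∧ ∀ e, s (γ • e) = σ.act (s e) g⁻¹ := by
  obtain ⟨h, hh⟩ := σ.exists_act_eq (p := s 0) (q := s (γ • 0))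
    (by rw [hs.proj_eq, hs.proj_eq, orbitProj_smul])
  have hframe : ∀ e A, frame Γ (γ • e) (⟨_, hγ⟩ * A) = frame Γ e A := fun e A =>
    frame_smul Γ γ e A ⟨_, hγ⟩ rfl
  have h1 : ⟨_, hγ⟩ * spinCover n h = 1 := by
    apply frame_injective Γ (γ • (0 : Euc n))
    rw [hframe, ← hs.lam_act, hh, hs.lam_eq]
  refine ⟨h⁻¹, ?_, ?_⟩
  · rw [map_inv, ← eq_inv_of_mul_eq_one_left h1]
  · rw [inv_inv]
    refine congrFun (σ.isCoveringMap_lam.eq_of_comp_eq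
      (hs.continuous.comp (continuous_const_smul γ))
      ((σ.continuous_act_right h).comp hs.continuous) (funext fun e => ?_) 0 hh.symm)
    change σ.lam (s (γ • e)) = σ.lam (σ.act (s e) h)
    rw [hs.lam_eq, hs.lam_act, ← hframe e (spinCover n h), h1]

/-- Computing `s(γδ 0)` in two ways and cancelling by freeness gives multiplicativity; the inverses
reconcile the left action of `Γ` with the right action of `Spin(n)`. -/
theorem IsFrameLift.exists_hom {s : Euc n → σ.P} (hs : σ.IsFrameLift s)
    (hΓ : ∀ γ : Γ, rot n (γ : Motion n) ∈ SO n) :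
    ∃ ε : Γ →* Spin n, (∀ γ : Γ, (spinCover n (ε γ) : OrthGroup n) = rot n γ) ∧
      ∀ (γ : Γ) e, s (γ • e) = σ.act (s e) (ε γ)⁻¹ := by
  choose ε hε hsε using fun γ => hs.exists_smul_eq (hΓ γ)
  refine ⟨MonoidHom.mk' ε fun γ δ => ?_, hε, hsε⟩
  rw [← inv_inj]
  apply σ.act_injective (s 0)
  rw [← hsε, mul_smul, hsε, hsε, ← σ.act_mul, mul_inv_rev]

/-- The map `[e, g] ↦ s(e) g` is well defined by the relation between `s` and `ε`. It is bijective
because `Spin(n)` acts simply transitively on the fibres of `P`, and a homeomorphism because its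
source is compact and `P` is Hausdorff. -/
theorem IsFrameLift.equivalent {s : Euc n → σ.P} (hs : σ.IsFrameLift s) {ε : Γ →* Spin n}
    (hε : ∀ γ : Γ, (spinCover n (ε γ) : OrthGroup n) = rot n γ)
    (hsε : ∀ (γ : Γ) e, s (γ • e) = σ.act (s e) (ε γ)⁻¹) :
    (spinStructureOfHom ε hε).Equivalent σ := by
  let F : Total ε → σ.P := Total.lift (fun e g => σ.act (s e) g) fun γ e g => by
    rw [hsε, ← σ.act_mul, inv_mul_cancel_left]
  have hFmk : ∀ e g, F (Total.mk ε e g) = σ.act (s e) g := fun _ _ => rfl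
  have hc : Continuous F := Total.continuous_lift
    (σ.continuous_act.comp ((hs.continuous.comp continuous_fst).prodMk continuous_snd))
  have hlam : ∀ p, σ.lam (F p) = Total.lam hε p := by
    intro p
    obtain ⟨e, g, rfl⟩ := Total.exists_mk_eq p
    rw [hFmk, hs.lam_act, Total.lam_mk]
  have hact : ∀ p g, F (Total.act p g) = σ.act (F p) g := by
    intro p g
    obtain ⟨e, h, rfl⟩ := Total.exists_mk_eq p
    rw [Total.act_mk, hFmk, hFmk, σ.act_mul]
  have hbij : Function.Bijective F := by
    constructor
    · intro p q hpq
      obtain ⟨c, -, rfl⟩ := Total.exists_act_of_lam_eq hε (p := p) (q := q)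
        (by rw [← hlam, hpq, hlam])
      rw [hact] at hpq
      have h1 : c = 1 := σ.act_injective (F q) (by rw [hpq, σ.act_one])
      exact Total.act_eq_self_iff.2 h1
    · intro p
      obtain ⟨e, he⟩ := (isQuotientCoveringMap_orbitProj Γ).surjective (σ.proj p)
      obtain ⟨g, hg⟩ := σ.exists_act_eq (p := s e) (q := p) (by rw [hs.proj_eq, he])
      exact ⟨Total.mk ε e g, hg⟩
  exact ⟨Continuous.homeoOfEquivCompactToT2 (X := Total ε) (f := Equiv.ofBijective F hbij) hc, hact, hlam⟩

/-- Replacing `s` by `s · c` conjugates the homomorphism by `c`, and `c ∈ ker λ_n` is central. -/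
theorem IsFrameLift.hom_unique {s t : Euc n → σ.P} (hs : σ.IsFrameLift s)
    (ht : σ.IsFrameLift t) {ε ε' : Γ →* Spin n}
    (hsε : ∀ (γ : Γ) e, s (γ • e) = σ.act (s e) (ε γ)⁻¹)
    (htε : ∀ (γ : Γ) e, t (γ • e) = σ.act (t e) (ε' γ)⁻¹) : ε = ε' := by
  obtain ⟨c, hc, hcs⟩ := hs.exists_eq_act ht
  ext1 γ
  have h := htε γ 0
  rw [hcs, hcs, hsε, ← σ.act_mul, ← σ.act_mul] at h
  have h1 := σ.act_injective _ h
  rw [← mul_comm_of_spinCover_eq_one hc, mul_right_inj] at h1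
  exact inv_injective h1

end SpinStructure

section Classification

variable {n : ℕ} {Γ : Subgroup (Motion n)} [IsBieberbach Γ]

theorem isFrameLift_mk {ε : Γ →* Spin n}
    (hε : ∀ γ : Γ, (spinCover n (ε γ) : OrthGroup n) = rot n γ) :
    (spinStructureOfHom ε hε).IsFrameLift fun e => Total.mk ε e 1 where
  continuous := Total.isOpenQuotientMap_mk.continuous.comp
    (continuous_id.prodMk continuous_const)
  lam_eq e := (Total.lam_mk hε e 1).trans (by rw [map_one])

theorem mk_one_smul (ε : Γ →* Spin n) (γ : Γ) (e : Euc n) :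
    Total.mk ε (γ • e) 1 = Total.act (Total.mk ε e 1) (ε γ)⁻¹ := by
  rw [Total.act_mk, one_mul, ← Total.mk_smul γ e, mul_inv_cancel]

/-- An equivalence carries the canonical lift `e ↦ [e, 1]` to a frame lift in the other model with
the same `ε`. -/
theorem hom_eq_of_equivalent {ε ε' : Γ →* Spin n}
    (hε : ∀ γ : Γ, (spinCover n (ε γ) : OrthGroup n) = rot n γ)
    (hε' : ∀ γ : Γ, (spinCover n (ε' γ) : OrthGroup n) = rot n γ)
    (h : (spinStructureOfHom ε hε).Equivalent (spinStructureOfHom ε' hε')) : ε = ε' := by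
  obtain ⟨f, hact, hlam⟩ := h
  have hs : (spinStructureOfHom ε' hε').IsFrameLift fun e => f (Total.mk ε e 1) :=
    ⟨f.continuous.comp (isFrameLift_mk hε).continuous,
      fun e => (hlam _).trans ((isFrameLift_mk hε).lam_eq e)⟩
  exact hs.hom_unique (isFrameLift_mk hε')
    (fun γ e => (congrArg f (mk_one_smul ε γ e)).trans (hact (Total.mk ε e 1) (ε γ)⁻¹)) (mk_one_smul ε')

/-- Spin structures on `ℝⁿ/Γ` correspond to lifts of the holonomy representation to `Spin(n)`. -/
theorem nonempty_equiv_lifts (hΓ : holonomyGroup Γ ≤ SO n) :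
    Nonempty ({ε : Γ →* Spin n // ∀ γ : Γ, (spinCover n (ε γ) : OrthGroup n) = rot n γ} ≃
      SpinStructures Γ) := by
  refine ⟨Equiv.ofBijective
    (fun ε => Quotient.mk (SpinStructure.setoid Γ) (spinStructureOfHom ε.1 ε.2)) ⟨?_, ?_⟩⟩
  · intro ε ε' h
    exact Subtype.ext (hom_eq_of_equivalent ε.2 ε'.2 (Quotient.exact h))
  · intro x
    induction x using Quotient.inductionOn with
    | h σ =>
      obtain ⟨s, hs⟩ := σ.exists_isFrameLift
      obtain ⟨ε, hε, hsε⟩ := hs.exists_hom fun γ => hΓ ⟨γ, γ.2, rfl⟩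
      exact ⟨⟨ε, hε⟩, Quotient.sound (hs.equivalent hε hsε)⟩

end Classification

/-! ### Equivalent orthogonal representations -/

section Polar

variable {n : ℕ}

/-- The orthogonal part of the polar decomposition of `B` intertwines every pair of orthogonal
maps that `B` intertwines. -/
theorem exists_orthogonal_intertwiner (B : Euc n ≃ₗ[ℝ] Euc n) :
    ∃ C : OrthGroup n, ∀ g h : OrthGroup n, (∀ v, h (B v) = B (g v)) →
      ∀ v, h (C v) = C (g v) := by
  let S : Euc n →ₗ[ℝ] Euc n := LinearMap.adjoint (B : Euc n →ₗ[ℝ] Euc n) ∘ₗ B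
  have hS : ∀ v w, inner ℝ (S v) w = inner ℝ (B v) (B w) := fun v w =>
    LinearMap.adjoint_inner_left (B : Euc n →ₗ[ℝ] Euc n) w (B v)
  have hsymm : S.IsSymmetric := fun v w => by
    rw [hS, real_inner_comm (S w), hS, real_inner_comm]
  let b := hsymm.eigenvectorBasis finrank_euclideanSpace_fin
  let μ := hsymm.eigenvalues finrank_euclideanSpace_fin
  have hb : ∀ i, S (b i) = μ i • b i := fun i =>
    hsymm.apply_eigenvectorBasis finrank_euclideanSpace_fin i
  have hB : ∀ i j, inner ℝ (B (b i)) (B (b j)) = μ i * if i = j then 1 else 0 := fun i j => by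
    rw [← hS, hb, real_inner_smul_left, orthonormal_iff_ite.1 b.orthonormal]
  have hμ : ∀ i, 0 < μ i := fun i => by
    have h := hB i i
    rw [if_pos rfl, mul_one] at h
    rw [← h, real_inner_self_pos]
    exact (B.map_ne_zero_iff).2 (b.orthonormal.ne_zero i)
  -- The polynomial takes the value `μ^(-1/2)` at every eigenvalue `μ` of `S = BᵀB`. So `R = p(S)`
  -- is `S^(-1/2)`, and as a polynomial in `S` it commutes with whatever commutes with `S`. The
  -- isometry sought is `B R`.
  let p := Lagrange.interpolate (Finset.univ.image μ) id fun x => (√x)⁻¹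
  have hp : ∀ i, p.eval (μ i) = (√(μ i))⁻¹ := fun i =>
    Lagrange.eval_interpolate_at_node (v := id) _ (Function.injective_id.injOn)
      (Finset.mem_image_of_mem μ (Finset.mem_univ i))
  let R : Euc n →ₗ[ℝ] Euc n := Polynomial.aeval S p
  have hR : ∀ i, R (b i) = (√(μ i))⁻¹ • b i := fun i => by
    have h : Module.End.HasEigenvector S (μ i) (b i) :=
      ⟨Module.End.mem_eigenspace_iff.2 (hb i), b.orthonormal.ne_zero i⟩
    rw [← hp]
    exact Module.End.aeval_apply_of_hasEigenvector h
  have horth : Orthonormal ℝ (((B : Euc n →ₗ[ℝ] Euc n) ∘ₗ R) ∘ b.toBasis) := by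
    rw [orthonormal_iff_ite]
    intro i j
    have h1 : ∀ i, (((B : Euc n →ₗ[ℝ] Euc n) ∘ₗ R) ∘ b.toBasis) i = (√(μ i))⁻¹ • B (b i) :=
      fun i => by simp [hR]
    rw [h1, h1, real_inner_smul_left, real_inner_smul_right, hB]
    by_cases h : i = j
    · subst h
      have h2 : √(μ i) ≠ 0 := (Real.sqrt_pos.2 (hμ i)).ne'
      rw [if_pos rfl, mul_one, ← mul_assoc, ← mul_inv, Real.mul_self_sqrt (hμ i).le,
        inv_mul_cancel₀ (hμ i).ne']
    · simp [h]
  let F := LinearMap.isometryOfOrthonormal ((B : Euc n →ₗ[ℝ] Euc n) ∘ₗ R)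
    (v := b.toBasis) (by simp) horth
  refine ⟨F.toLinearIsometryEquiv rfl, fun g h hgh v => ?_⟩
  let g' : Module.End ℝ (Euc n) := (g.toLinearEquiv : Euc n →ₗ[ℝ] Euc n)
  -- The form `⟨Bv, Bw⟩` defining `S` is invariant under `g`, because `B g = h B` and `h` is
  -- orthogonal.
  have hcomm : S ∈ Subalgebra.centralizer ℝ {g'} := by
    rw [Subalgebra.mem_centralizer_iff]
    rintro _ rfl
    refine LinearMap.ext fun v => ext_inner_right ℝ fun w => ?_
    change inner ℝ (g (S v)) w = inner ℝ (S (g v)) w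
    rw [hS, ← hgh, ← g.apply_symm_apply w, g.inner_map_map, hS, ← hgh, h.inner_map_map]
  have hR' : R ∈ Subalgebra.centralizer ℝ {g'} :=
    (Algebra.adjoin_le (Set.singleton_subset_iff.2 hcomm))
      (Polynomial.aeval_mem_adjoin_singleton ℝ S)
  have hgR : g (R v) = R (g v) := congrArg (fun T : Module.End ℝ (Euc n) => T v)
    (Subalgebra.mem_centralizer_iff ℝ |>.1 hR' g' rfl)
  change h (B (R v)) = B (R (g v))
  rw [hgh, hgR]

/-- The automorphism of `C_n` induced by an orthogonal map. -/
noncomputable def cliffMap (C : OrthGroup n) : Cliff n →ₐ[ℝ] Cliff n :=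
  CliffordAlgebra.map
    { (C.toLinearEquiv : Euc n →ₗ[ℝ] Euc n) with
      map_app' := fun v => by
        change negNormSq n (C v) = _
        rw [negNormSq_apply, negNormSq_apply, C.norm_map] }

theorem cliffMap_vec (C : OrthGroup n) (v : Euc n) : cliffMap C (vec v) = vec (C v) :=
  CliffordAlgebra.map_apply_ι _ _

theorem cliffMap_inv_apply (C : OrthGroup n) (x : Cliff n) : cliffMap C⁻¹ (cliffMap C x) = x := by
  have h : (cliffMap C⁻¹).comp (cliffMap C) = AlgHom.id ℝ (Cliff n) := by
    refine CliffordAlgebra.hom_ext (LinearMap.ext fun v => ?_)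
    change cliffMap C⁻¹ (cliffMap C (vec v)) = vec v
    rw [cliffMap_vec, cliffMap_vec]
    exact congrArg vec (C.symm_apply_apply v)
  exact DFunLike.congr_fun h x

theorem involute_cliffMap (C : OrthGroup n) (x : Cliff n) :
    CliffordAlgebra.involute (cliffMap C x) = cliffMap C (CliffordAlgebra.involute x) := by
  induction x using CliffordAlgebra.induction with
  | algebraMap r => simp only [AlgHom.commutes]
  | ι v => rw [cliffMap_vec, CliffordAlgebra.involute_ι, CliffordAlgebra.involute_ι, map_neg,
      cliffMap_vec]
  | mul a b ha hb => rw [map_mul, map_mul, ha, hb, map_mul, map_mul]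
  | add a b ha hb => rw [map_add, map_add, ha, hb, map_add, map_add]

theorem star_cliffMap (C : OrthGroup n) (x : Cliff n) :
    star (cliffMap C x) = cliffMap C (star x) := by
  induction x using CliffordAlgebra.induction with
  | algebraMap r => simp only [AlgHom.commutes, CliffordAlgebra.star_algebraMap]
  | ι v => rw [cliffMap_vec, CliffordAlgebra.star_ι, CliffordAlgebra.star_ι, map_neg,
      cliffMap_vec]
  | mul a b ha hb => rw [map_mul, star_mul, ha, hb, star_mul, map_mul]
  | add a b ha hb => rw [map_add, star_add, ha, hb, star_add, map_add]

theorem cliffMap_conj (C : OrthGroup n) (x : Spin n) (v : Euc n) :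
    cliffMap C x * vec v * star (cliffMap C x) =
      vec (C ((spinCover n x : OrthGroup n) (C.symm v))) := by
  rw [← cliffMap_vec, ← spinCover_spec, map_mul, map_mul, cliffMap_vec, C.apply_symm_apply,
    star_cliffMap]

/-- The endomorphism of `Spin(n)` induced by an orthogonal map. -/
noncomputable def spinMap (C : OrthGroup n) : Spin n →* Spin n :=
  MonoidHom.mk' (fun x => ⟨⟨cliffMap C x, by
      rw [Unitary.mem_iff, star_cliffMap, ← map_mul, ← map_mul,
        Unitary.star_mul_self_of_mem x.1.2, Unitary.mul_star_self_of_mem x.1.2, map_one]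
      exact ⟨rfl, rfl⟩⟩,
    by rw [involute_cliffMap, x.2.1], fun v => ⟨_, cliffMap_conj C x v⟩⟩)
    fun x y => spin_coe_injective (map_mul (cliffMap C) _ _)

theorem spinMap_inv_apply (C : OrthGroup n) (x : Spin n) : spinMap C⁻¹ (spinMap C x) = x :=
  spin_coe_injective (cliffMap_inv_apply C x)

/-- The automorphism of `C_n` extending `C` respects products and the bar. No condition on `det C`
is needed, and none is available: the orthogonal factor of `B` may reverse orientation. -/
theorem spinCover_spinMap (C : OrthGroup n) (x : Spin n) :
    (spinCover n (spinMap C x) : OrthGroup n) = C * spinCover n x * C⁻¹ := by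
  ext1 v
  apply vec_injective
  rw [← spinCover_spec]
  exact cliffMap_conj C x v

end Polar

end FlatSpin

theorem mainTheorem1 (n : ℕ) (Γ : Subgroup (Motion n)) [IsBieberbach Γ]
    (hΓ : holonomyGroup Γ ≤ SO n)
    (φ : holonomyGroup Γ →* SO n) (hφ : EquivalentToInclusion φ) :
    Nonempty (SpinStructures Γ ≃
      {ε : Γ →* Spin n // ∀ γ : Γ, spinCover n (ε γ) = φ (holonomyRep Γ γ)}) := by
  obtain ⟨e⟩ := nonempty_equiv_lifts hΓ
  obtain ⟨B, hB⟩ := hφ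
  obtain ⟨C, hC⟩ := exists_orthogonal_intertwiner B
  have hφC : ∀ γ : Γ, (φ (holonomyRep Γ γ) : OrthGroup n) = C * rot n γ * C⁻¹ := by
    intro γ
    rw [eq_mul_inv_iff_mul_eq]
    ext1 v
    exact hC _ _ (hB (holonomyRep Γ γ)) v
  -- Lifts of `r` and lifts of `φ ∘ r = C r C⁻¹` are exchanged by composition with `spinMap C` and
  -- `spinMap C⁻¹`.
  refine ⟨e.symm.trans ⟨fun ε => ⟨(spinMap C).comp ε.1, fun γ => Subtype.ext ?_⟩,
    fun ε => ⟨(spinMap C⁻¹).comp ε.1, fun γ => ?_⟩, fun ε => Subtype.ext ?_,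
    fun ε => Subtype.ext ?_⟩⟩
  · rw [MonoidHom.comp_apply, spinCover_spinMap, ε.2, hφC]
  · rw [MonoidHom.comp_apply, spinCover_spinMap, ε.2, hφC]
    group
  · exact MonoidHom.ext fun γ => spinMap_inv_apply C _
  · refine MonoidHom.ext fun γ => ?_
    have h := spinMap_inv_apply C⁻¹ (ε.1 γ)
    rwa [inv_inv] at h
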